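/- Let $P\subset\mathbb{R}^d$ and $Q\subset\mathbb{R}^e$ be finite point sets, each containing the origin $0$ and having $0$ in the interior of its convex hull. A triangulation of a finite point set $A$ is a geometric simplicial complex with vertices in $A$ that covers $\operatorname{conv} A$; $\Delta^{=k}$ denotes the set of its $k$-simplices, and $\operatorname{st}_\Delta(0)$ the subcomplex of all simplices containing $0$ and all their faces. Let $P\oplus Q=(P\times\{0\})\cup(\{0\}\times Q)\subset\mathbb{R}^{d+e}$, and for simplices $\sigma\subset\mathbb{R}^d$, $\tau\subset\mathbb{R}^e$ let $\sigma\oplus\tau=\operatorname{conv}\big((\sigma\times\{0\})\cup(\{0\}\times\tau)\big)$. For full-dimensional simplices $\sigma,\tau$ of a triangulation write $\sigma\preceq\tau$ if $\sigma=\tau$, or if every hyperplane weakly separating $\sigma$ from $\tau$ has $\sigma$ and $0$ in the same closed half-space and at least one hyperplane weakly separating them does not contain $0$. A set $S$ is strictly star shaped with respect to $0\in S$ if for every $y\in S$ the segment $\overline{0y}$ is contained in $\operatorname{relint}(S)\cup\{y\}$. For a triangulation $\Delta$ in $\mathbb{R}^k$ let $\mathcal{B}_\Delta$ consist of the empty complex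 and all subcomplexes of $\Delta$ that are $k$-dimensional balls and strictly star shaped with respect to $0$, ordered by inclusion. Let $\Delta_P,\Delta_Q$ be triangulations of $P,Q$. A web of stars in $\Delta_Q$ with respect to $\Delta_P$ is a map $\alpha:\Delta_P^{=d}\to\mathcal{B}_{\Delta_Q}$ such that $\sigma\preceq\tau$ implies $\alpha(\sigma)\subseteq\alpha(\tau)$. Webs of stars $\alpha:\Delta_P^{=d}\to\mathcal{B}_{\Delta_Q}$ and $\beta:\Delta_Q^{=e}\to\mathcal{B}_{\Delta_P}$ are compatible if $\sigma\in\beta(\tau)\iff\tau\notin\alpha(\sigma)$ for all $\sigma\in\Delta_P^{=d}$, $\tau\in\Delta_Q^{=e}$. Call a web of stars $\alpha$ proper if $\alpha(\sigma)=\operatorname{st}_{\Delta_Q}(0)$ for every $d$-simplex $\sigma\in\operatorname{st}_{\Delta_P}(0)$, and the complementary transposed map $\beta$, which sends $\tau\in\Delta_Q^{=e}$ to the subcomplex of $\Delta_P$ generated by all $\sigma\in\Delta_P^{=d}$ with $\tau\notin\alpha(\sigma)$, is also a web of stars. For a $k$-ball $B$ let $(\partial B)^{=k-1}$ be the set of $(k-1)$-simplices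 lying in exactly one $k$-simplex of $B$ (for $k=0$ this is the empty simplex). Put $$\mathcal{T}(\alpha,\beta)=\bigcup_{\sigma_P\in\Delta_P^{=d}}\{\sigma_P\oplus\sigma_Q \mid \sigma_Q\in(\partial\alpha(\sigma_P))^{=e-1}\}\ \cup\bigcup_{\tau_Q\in\Delta_Q^{=e},\ \beta(\tau_Q)\neq\emptyset}\{\tau_P\oplus\tau_Q \mid \tau_P\in(\partial\beta(\tau_Q))^{=d-1}\}.$$ A $P$-sum-triangulation of $\Delta_P$ and $\Delta_Q$ is a triangulation of $P\oplus Q$ whose set of $(d+e)$-simplices is $\mathcal{T}(\alpha,\beta)$ for some compatible pair of webs of stars $\alpha,\beta$ such that $\alpha(\sigma)=\operatorname{st}_{\Delta_Q}(0)$ for every $d$-simplex $\sigma\in\operatorname{st}_{\Delta_P}(0)$. Theorem. Let $\alpha:\Delta_P^{=d}\to\mathcal{B}_{\Delta_Q}$ be a proper web of stars, with complementary transposed map $\beta$. Then the elements of $\mathcal{T}(\alpha,\beta)$ together with all their faces form a triangulation of $P\oplus Q$. Its maximal cells are exactly the elements of $\mathcal{T}(\alpha,\beta)$, these are exactly its $(d+e)$-simplices,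 and it is a $P$-sum-triangulation of $\Delta_P$ and $\Delta_Q$. -/

import Mathlib

namespace FreeSumWebs

open Geometry

section General

variable {E F : Type*} [NormedAddCommGroup E] [NormedSpace ℝ E]
  [NormedAddCommGroup F] [NormedSpace ℝ F]

/-- The free sum `P ⊕ Q = (P × {0}) ∪ ({0} × Q)` of two point sets. -/
def freeSum (P : Set E) (Q : Set F) : Set (E × F) :=
  (P ×ˢ ({0} : Set F)) ∪ (({0} : Set E) ×ˢ Q)

/-- A triangulation of the point configuration `P`: a geometric simplicial complex all of whose
vertices belong to `P` (not every point of `P` has to be used) and which covers `conv P`. -/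
structure IsTriangulation (K : SimplicialComplex ℝ E) (P : Set E) : Prop where
  vertices_subset : K.vertices ⊆ P
  space_eq : K.space = convexHull ℝ P

/-- The `k`-dimensional simplices of `K` (given by their vertex sets). -/
abbrev Cell (K : SimplicialComplex ℝ E) (k : ℕ) : Type _ :=
  {s : Finset E // s ∈ K.faces ∧ s.card = k + 1}

/-- The closed star of a point `x`: all simplices containing `x` (equivalently, containing the
minimal face of `K` on which `x` lies), together with all their faces. -/
def starAt (K : SimplicialComplex ℝ E) (x : E) : SimplicialComplex ℝ E where
  faces := {s | s ∈ K.faces ∧ ∃ t ∈ K.faces, s ⊆ t ∧ x ∈ convexHull ℝ (t : Set E)}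
  indep := fun hs => K.indep hs.1
  isRelLowerSet_faces := by
    rintro s ⟨hs, t, ht, hst, hx⟩
    refine ⟨K.nonempty_of_mem_faces hs, fun u hu hne => ?_⟩
    exact ⟨K.down_closed hs hu hne, t, ht, hu.trans hst, hx⟩
  inter_subset_convexHull := fun hs ht => K.inter_subset_convexHull hs.1 ht.1

/-- `S` is strictly star shaped with respect to `x ∈ S`: for every `y ∈ S` the segment from `x` to
`y` is contained in `relint S ∪ {y}`. -/
def StrictlyStarShaped (x : E) (S : Set E) : Prop :=
  x ∈ S ∧ ∀ y ∈ S, segment ℝ x y ⊆ intrinsicInterior ℝ S ∪ {y}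

/-- `B` is a `k`-dimensional simplicial ball: a pure `k`-dimensional complex whose underlying space
is homeomorphic to the closed unit ball of `ℝ^k`. -/
structure IsSimplicialBall (B : SimplicialComplex ℝ E) (k : ℕ) : Prop where
  pure : ∀ s ∈ B.faces, ∃ t ∈ B.faces, s ⊆ t ∧ t.card = k + 1
  homeo : Nonempty (B.space ≃ₜ Metric.closedBall (0 : EuclideanSpace ℝ (Fin k)) 1)

/-- The poset of all subcomplexes of `K` that are `k`-dimensional balls, strictly star shaped
with respect to the origin, together with the empty complex; the order is the inclusion `≤` of
simplicial complexes. -/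
def starBalls (K : SimplicialComplex ℝ E) (k : ℕ) : Set (SimplicialComplex ℝ E) :=
  {B | B ≤ K ∧ (B = ⊥ ∨ (IsSimplicialBall B k ∧ StrictlyStarShaped 0 B.space))}

/-- The hyperplane `{x | f x = b}` weakly separates the simplices `σ` and `τ`, with `σ` on the
side `f ≤ b` and `τ` on the side `f ≥ b`. It is linear if `b = 0` and strictly affine if `b ≠ 0`. -/
def Separates (f : E →ₗ[ℝ] ℝ) (b : ℝ) (σ τ : Finset E) : Prop :=
  f ≠ 0 ∧ (∀ x ∈ convexHull ℝ (σ : Set E), f x ≤ b) ∧ (∀ x ∈ convexHull ℝ (τ : Set E), b ≤ f x)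

/-- The stabbing order: `σ = τ`, or every hyperplane separating `σ` and `τ` has `σ` and the
origin in the same closed half space, and some separating hyperplane does not contain the
origin. -/
def StabLE (σ τ : Finset E) : Prop :=
  σ = τ ∨
    ((∀ (f : E →ₗ[ℝ] ℝ) (b : ℝ), Separates f b σ τ → f 0 ≤ b) ∧
      ∃ (f : E →ₗ[ℝ] ℝ) (b : ℝ), Separates f b σ τ ∧ f 0 ≠ b)

/-- A web of stars in `KQ` with respect to `KP`, where `KP` lives in dimension `d` and `KQ` in
dimension `e`: an order preserving map from the `d`-simplices of `KP` with the stabbing order to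
the strictly star-shaped `e`-balls of `KQ` with inclusion. -/
structure IsWebOfStars (d e : ℕ) (KP : SimplicialComplex ℝ E) (KQ : SimplicialComplex ℝ F)
    (α : Cell KP d → SimplicialComplex ℝ F) : Prop where
  mem_starBalls : ∀ σ, α σ ∈ starBalls KQ e
  mono : ∀ σ τ : Cell KP d, StabLE σ.1 τ.1 → α σ ≤ α τ

/-- Compatibility: `σ ∈ β τ ↔ τ ∉ α σ`. -/
def Compatible {d e : ℕ} {KP : SimplicialComplex ℝ E} {KQ : SimplicialComplex ℝ F}
    (α : Cell KP d → SimplicialComplex ℝ F) (β : Cell KQ e → SimplicialComplex ℝ E) : Prop :=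
  ∀ (σ : Cell KP d) (τ : Cell KQ e), σ.1 ∈ (β τ).faces ↔ τ.1 ∉ (α σ).faces

/-- The `d`-simplices in the star of the origin are sent to the whole star of the origin. -/
def StarCondition {d : ℕ} {KP : SimplicialComplex ℝ E} (KQ : SimplicialComplex ℝ F)
    (α : Cell KP d → SimplicialComplex ℝ F) : Prop :=
  ∀ σ : Cell KP d, σ.1 ∈ (starAt KP 0).faces → α σ = starAt KQ 0

/-- The complementary transposed map `β` of `α`: `β τ` is the subcomplex of `KP` generated by the
`d`-simplices `σ` with `τ ∉ α σ`. -/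
def transposed {d e : ℕ} {KP : SimplicialComplex ℝ E} {KQ : SimplicialComplex ℝ F}
    (α : Cell KP d → SimplicialComplex ℝ F) (τ : Cell KQ e) : SimplicialComplex ℝ E where
  faces := {s | s ∈ KP.faces ∧ ∃ σ : Cell KP d, τ.1 ∉ (α σ).faces ∧ s ⊆ σ.1}
  indep := fun hs => KP.indep hs.1
  isRelLowerSet_faces := by
    rintro s ⟨hs, σ, hσ, hsσ⟩
    refine ⟨KP.nonempty_of_mem_faces hs, fun u hu hne => ?_⟩
    exact ⟨KP.down_closed hs hu hne, σ, hσ, hu.trans hsσ⟩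
  inter_subset_convexHull := fun hs ht => KP.inter_subset_convexHull hs.1 ht.1

/-- A web of stars is proper if it satisfies the star condition and the complementary transposed
map is a web of stars, too. -/
structure IsProperWeb (d e : ℕ) (KP : SimplicialComplex ℝ E) (KQ : SimplicialComplex ℝ F)
    (α : Cell KP d → SimplicialComplex ℝ F) : Prop where
  web : IsWebOfStars d e KP KQ α
  star : StarCondition KQ α
  web_transposed : IsWebOfStars e d KQ KP (transposed (e := e) (KQ := KQ) α)

/-- The `(k-1)`-simplices of the boundary complex `∂B` of a `k`-dimensional ball `B`: the
`(k-1)`-simplices contained in exactly one `k`-simplex of `B`. For `k = 0` this is the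
`(-1)`-simplex `∅` if `B` is a point. If `B` is empty, there are none. -/
def boundaryFacets (B : SimplicialComplex ℝ E) (k : ℕ) : Set (Finset E) :=
  {s | s.card = k ∧ ∃! t : Finset E, t ∈ B.faces ∧ t.card = k + 1 ∧ s ⊆ t}

open Classical in
/-- The vertex set of `σ ⊕ τ = conv ((σ × {0}) ∪ ({0} × τ))`. -/
noncomputable def sumCell (σ : Finset E) (τ : Finset F) : Finset (E × F) :=
  σ.image (fun x => (x, (0 : F))) ∪ τ.image (fun y => ((0 : E), y))

/-- The simplices `σ ⊕ ρ` with `σ` a `d`-simplex of `KP` and `ρ` a facet of `∂(α σ)`, together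
with the simplices `ρ ⊕ τ` with `τ` an `e`-simplex of `KQ`, `β τ ≠ ∅` and `ρ` a facet of
`∂(β τ)`. -/
def sumCells {d e : ℕ} {KP : SimplicialComplex ℝ E} {KQ : SimplicialComplex ℝ F}
    (α : Cell KP d → SimplicialComplex ℝ F) (β : Cell KQ e → SimplicialComplex ℝ E) :
    Set (Finset (E × F)) :=
  {s | ∃ σ : Cell KP d, ∃ ρ ∈ boundaryFacets (α σ) e, s = sumCell σ.1 ρ} ∪
    {s | ∃ τ : Cell KQ e, β τ ≠ ⊥ ∧ ∃ ρ ∈ boundaryFacets (β τ) d, s = sumCell ρ τ.1}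

/-- The set of simplices of `𝒯(KP, KQ, α)`. -/
def webCells {d : ℕ} (e : ℕ) {KP : SimplicialComplex ℝ E} (KQ : SimplicialComplex ℝ F)
    (α : Cell KP d → SimplicialComplex ℝ F) : Set (Finset (E × F)) :=
  sumCells α (transposed (e := e) (KQ := KQ) α)

/-- `K` is a `P`-sum-triangulation of the free sum `P ⊕ Q` with respect to triangulations `KP`
of `P` and `KQ` of `Q`, in dimensions `d` and `e`. -/
def IsPSumTriangulation (d e : ℕ) (P : Set E) (Q : Set F) (KP : SimplicialComplex ℝ E)
    (KQ : SimplicialComplex ℝ F) (K : SimplicialComplex ℝ (E × F)) : Prop :=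
  IsTriangulation K (freeSum P Q) ∧
    ∃ (α : Cell KP d → SimplicialComplex ℝ F) (β : Cell KQ e → SimplicialComplex ℝ E),
      IsWebOfStars d e KP KQ α ∧ IsWebOfStars e d KQ KP β ∧ Compatible α β ∧
      StarCondition KQ α ∧
      {s | s ∈ K.faces ∧ s.card = d + e + 1} = sumCells α β

end General

end FreeSumWebs

set_option linter.unusedSectionVars false

/-! Write a point of `conv (P ⊕ Q)` as `z = (l • p, (1 - l) • q)` with `p ∈ conv P`, `q ∈ conv Q`.
Raising `l` moves `p` towards the origin and `q` away from it. Label a product `σ × τ` of top cells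
by α if `τ ∈ α σ` and by β if `σ ∈ β τ`; compatibility says that exactly one label applies. If `σ ∈
β τ`, contracting `p` stays inside `β τ`, and dually for `α σ`. So as `l` grows the label can change
from α to β but never back (`no_crossing`). The cells of `sumCells α β` record where the change
happens: there `(p, q)` lies in some `σ × ∂(α σ)` or `∂(β τ) × τ`.

Two cells containing `z` must use the same `l`: at an interior parameter point each cell touches
products of both labels, so different values would produce a forbidden change (`not_lt_of_mem`).
With `l` equal, intersections are computed separately in the two given triangulations
(`inter_sumCell`). Conversely, the decompositions of `z` form a compact set, and an extremal one
gives a cell containing `z` (`exists_factorPair`).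

The geometric input about a star-shaped ball is that its topological boundary is the union of its
boundary facets (`notMem_interior_of_mem_boundaryFacets`, `exists_boundaryFacet`) and that the
vertices of such a facet are linearly independent. The latter makes each sum cell a simplex of
dimension `d + e`. -/

namespace FreeSumWebs

open Geometry Module Topology Filter

/-! ### Barycentric coordinates of full-dimensional simplices -/

section Simplex

variable {E : Type*} [NormedAddCommGroup E] [NormedSpace ℝ E]

/-- Barycentric coordinates of a simplex whose vertices affinely span the space. -/
structure IsCoord (t : Finset E) (c : E → E →ᵃ[ℝ] ℝ) : Prop where
  self : ∀ v ∈ t, c v v = 1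
  ne : ∀ v ∈ t, ∀ w ∈ t, v ≠ w → c v w = 0
  sum : ∀ x, ∑ v ∈ t, c v x = 1
  combo : ∀ x, ∑ v ∈ t, c v x • v = x
  mem_hull : ∀ x, x ∈ convexHull ℝ (t : Set E) ↔ ∀ v ∈ t, 0 ≤ c v x
  mem_interior : ∀ x, x ∈ interior (convexHull ℝ (t : Set E)) ↔ ∀ v ∈ t, 0 < c v x

theorem exists_isCoord [FiniteDimensional ℝ E] {t : Finset E}
    (ht : AffineIndependent ℝ ((↑) : t → E)) (hcard : t.card = finrank ℝ E + 1) :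
    ∃ c, IsCoord t c := by
  classical
  have htop : affineSpan ℝ (Set.range ((↑) : t → E)) = ⊤ := by
    rw [ht.affineSpan_eq_top_iff_card_eq_finrank_add_one]
    simpa using hcard
  let b : AffineBasis t ℝ E := ⟨(↑), ht, htop⟩
  have hr : Set.range b = (t : Set E) := by
    change Set.range ((↑) : t → E) = _
    simp
  let c : E → E →ᵃ[ℝ] ℝ := fun v => if h : v ∈ t then b.coord ⟨v, h⟩ else 0
  have hc : ∀ v : t, c v = b.coord v := fun v => by simp [c]
  refine ⟨c, ?_, ?_, ?_, ?_, ?_, ?_⟩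
  · intro v hv
    have := b.coord_apply_eq ⟨v, hv⟩
    rw [← hc] at this
    exact this
  · intro v hv w hw h
    have := b.coord_apply_ne (i := ⟨v, hv⟩) (j := ⟨w, hw⟩) (by simpa using h)
    rw [← hc] at this
    exact this
  · intro x
    rw [← Finset.sum_coe_sort]
    simp_rw [hc]
    exact b.sum_coord_apply_eq_one x
  · intro x
    rw [← Finset.sum_coe_sort t (fun v => c v x • v)]
    simp_rw [hc]
    exact b.linear_combination_coord_eq_self x
  · intro x
    rw [← hr, b.convexHull_eq_nonneg_coord]
    constructor
    · intro h v hv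
      have := h ⟨v, hv⟩
      rwa [← hc] at this
    · intro h i
      rw [← hc]
      exact h i i.2
  · intro x
    rw [← hr, b.interior_convexHull]
    constructor
    · intro h v hv
      have := h ⟨v, hv⟩
      rwa [← hc] at this
    · intro h i
      rw [← hc]
      exact h i i.2

theorem affineMap_sum (f : E →ᵃ[ℝ] ℝ) (s : Finset E) (w : E → ℝ) (hw : ∑ v ∈ s, w v = 1) :
    f (∑ v ∈ s, w v • v) = ∑ v ∈ s, w v * f v := by
  have h : ∀ x, f x = f.linear x + f 0 := fun x => by
    simpa using f.map_vadd 0 x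
  rw [h, map_sum]
  have h2 : ∀ v, w v * f v = f.linear (w v • v) + w v * f 0 := fun v => by
    rw [h v, map_smul, smul_eq_mul, mul_add]
  rw [Finset.sum_congr rfl fun v _ => h2 v, Finset.sum_add_distrib, ← Finset.sum_mul, hw, one_mul]

theorem affineMap_eq_zero_of_mem_convexHull (f : E →ᵃ[ℝ] ℝ) {s : Set E}
    (h : ∀ v ∈ s, f v = 0) {x : E} (hx : x ∈ convexHull ℝ s) : f x = 0 := by
  have : convexHull ℝ s ⊆ f ⁻¹' {0} :=
    convexHull_min (fun v hv => h v hv) ((convex_singleton 0).affine_preimage f)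
  exact this hx

theorem affineMap_line (f : E →ᵃ[ℝ] ℝ) (x y : E) (r : ℝ) :
    f (x + r • (y - x)) = f x + r * (f y - f x) := by
  have h : ∀ x, f x = f.linear x + f 0 := fun x => by
    simpa using f.map_vadd 0 x
  rw [h, h x, h y]
  simp only [map_add, map_smul, map_sub, smul_eq_mul]
  ring

theorem IsCoord.mem_convexHull_of_eq_zero {t s : Finset E} {c : E → E →ᵃ[ℝ] ℝ}
    (hc : IsCoord t c) {x : E} (hst : s ⊆ t) (h0 : ∀ v ∈ s, 0 ≤ c v x)
    (h : ∀ v ∈ t, v ∉ s → c v x = 0) : x ∈ convexHull ℝ (s : Set E) := by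
  rw [Finset.mem_convexHull']
  refine ⟨fun v => c v x, h0, ?_, ?_⟩
  · rw [← hc.sum x]
    exact Finset.sum_subset hst fun v hv hvs => h v hv hvs
  · conv_rhs => rw [← hc.combo x]
    refine Finset.sum_subset hst fun v hv hvs => ?_
    simp [h v hv hvs]

theorem IsCoord.eq_zero_of_mem_convexHull {t : Finset E} {c : E → E →ᵃ[ℝ] ℝ}
    (hc : IsCoord t c) {x : E} {s : Set E} (hst : s ⊆ t) (hx : x ∈ convexHull ℝ s) {v : E}
    (hv : v ∈ t) (hvs : v ∉ s) : c v x = 0 :=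
  affineMap_eq_zero_of_mem_convexHull (c v)
    (fun w hw => hc.ne v hv w (hst hw) (fun h => hvs (h ▸ hw))) hx

theorem IsCoord.affineMap_apply {t : Finset E} {c : E → E →ᵃ[ℝ] ℝ} (hc : IsCoord t c)
    (f : E →ᵃ[ℝ] ℝ) (x : E) : f x = ∑ v ∈ t, c v x * f v := by
  conv_lhs => rw [← hc.combo x]
  exact affineMap_sum f t _ (hc.sum x)

theorem IsCoord.exists_erase_of_notMem_interior [DecidableEq E] {t : Finset E} {c : E → E →ᵃ[ℝ] ℝ}
    (hc : IsCoord t c) {x : E} (hx : x ∈ convexHull ℝ (t : Set E))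
    (hxi : x ∉ interior (convexHull ℝ (t : Set E))) :
    ∃ v ∈ t, x ∈ convexHull ℝ (t.erase v : Set E) := by
  rw [hc.mem_interior] at hxi
  rw [hc.mem_hull] at hx
  push Not at hxi
  obtain ⟨v, hv, h⟩ := hxi
  refine ⟨v, hv, ?_⟩
  refine hc.mem_convexHull_of_eq_zero (Finset.erase_subset _ _)
    (fun w hw => hx w (Finset.mem_of_mem_erase hw)) fun w hw hws => ?_
  have : w = v := by
    by_contra hne
    exact hws (Finset.mem_erase.2 ⟨hne, hw⟩)
  subst this
  exact le_antisymm h (hx w hw)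

theorem IsCoord.closure_interior {t : Finset E} {c : E → E →ᵃ[ℝ] ℝ}
    (hc : IsCoord t c) : convexHull ℝ (t : Set E) ⊆ closure (interior (convexHull ℝ (t : Set E))) := by
  have hne : (interior (convexHull ℝ (t : Set E))).Nonempty := by
    refine ⟨∑ v ∈ t, (t.card : ℝ)⁻¹ • v, ?_⟩
    have hpos : 0 < (t.card : ℝ) := by
      have : t.Nonempty := by
        by_contra h
        have := hc.sum 0
        simp [Finset.not_nonempty_iff_eq_empty.1 h] at this
      exact_mod_cast this.card_pos
    rw [hc.mem_interior]
    intro v hv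
    rw [affineMap_sum _ _ (fun _ => (t.card : ℝ)⁻¹) (by simp [hpos.ne'])]
    refine Finset.sum_pos' (fun w hw => ?_) ⟨v, hv, ?_⟩
    · rcases eq_or_ne v w with rfl | h
      · rw [hc.self _ hv]; positivity
      · rw [hc.ne v hv w hw h]; simp
    · rw [hc.self _ hv]; positivity
  rw [(convex_convexHull ℝ _).closure_interior_eq_closure_of_nonempty_interior hne]
  exact subset_closure

/-- If two full-dimensional simplices share a facet and meet only there, then their union is a
neighbourhood of every relative interior point of the common facet. -/
theorem mem_interior_union_of_common_facet [FiniteDimensional ℝ E] {ρ t u : Finset E}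
    {c k : E → E →ᵃ[ℝ] ℝ} (hc : IsCoord t c) (hk : IsCoord u k) (hρt : ρ ⊆ t) (hρu : ρ ⊆ u)
    {v w : E} (hv : v ∈ t) (hvρ : v ∉ ρ) (hw : w ∈ u) (hwρ : w ∉ ρ)
    (ht : ∀ a ∈ t, a ∈ ρ ∨ a = v) (hu : ∀ a ∈ u, a ∈ ρ ∨ a = w)
    (hinter : convexHull ℝ (t : Set E) ∩ convexHull ℝ (u : Set E) ⊆ convexHull ℝ (ρ : Set E))
    {x : E} (hx : x ∈ convexHull ℝ (ρ : Set E)) (hcx : ∀ a ∈ ρ, 0 < c a x)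
    (hkx : ∀ a ∈ ρ, 0 < k a x) :
    x ∈ interior (convexHull ℝ (t : Set E) ∪ convexHull ℝ (u : Set E)) := by
  have hcv : c v x = 0 := hc.eq_zero_of_mem_convexHull (by exact_mod_cast hρt) hx hv (by simpa)
  have hkw : k w x = 0 := hk.eq_zero_of_mem_convexHull (by exact_mod_cast hρu) hx hw (by simpa)
  -- The vertices `v` and `w` lie on opposite sides of the common facet: otherwise the segment from
  -- `x` to `w` would start inside `t`, giving points of `t ∩ u` off `ρ`.
  have hneg : c v w < 0 := by
    by_contra! h
    have hcont : ∀ a ∈ ρ, ∀ᶠ r in 𝓝[>] (0 : ℝ), 0 < c a (x + r • (w - x)) := by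
      intro a ha
      have : Tendsto (fun r : ℝ => c a x + r * (c a w - c a x)) (𝓝[>] 0) (𝓝 (c a x)) := by
        refine Tendsto.mono_left ?_ nhdsWithin_le_nhds
        have : Continuous fun r : ℝ => c a x + r * (c a w - c a x) := by fun_prop
        simpa using this.tendsto 0
      filter_upwards [this.eventually (lt_mem_nhds (hcx a ha))] with r hr
      rwa [affineMap_line]
    have hall : ∀ᶠ r in 𝓝[>] (0 : ℝ), ∀ a ∈ ρ, 0 < c a (x + r • (w - x)) :=
      (Filter.eventually_all_finset ρ).2 hcont
    have h1 : ∀ᶠ r in 𝓝[>] (0 : ℝ), r < 1 :=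
      nhdsWithin_le_nhds (gt_mem_nhds one_pos)
    obtain ⟨r, ⟨hr, hr1⟩, hr0⟩ := ((hall.and h1).and self_mem_nhdsWithin).exists
    have hr0' : 0 < r := hr0
    have h2 : x + r • (w - x) ∈ convexHull ℝ (t : Set E) := by
      rw [hc.mem_hull]
      intro a ha
      rcases ht a ha with ha | rfl
      · exact (hr a ha).le
      · rw [affineMap_line, hcv]
        simp only [sub_zero, zero_add]
        positivity
    have h3 : x + r • (w - x) ∈ convexHull ℝ (u : Set E) := by
      refine (convex_convexHull ℝ _).add_smul_sub_mem
        (convexHull_mono (by exact_mod_cast hρu) hx) (subset_convexHull _ _ hw) ⟨hr0'.le, hr1.le⟩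
    have h4 := hk.eq_zero_of_mem_convexHull (by exact_mod_cast hρu) (hinter ⟨h2, h3⟩) hw (by simpa)
    rw [affineMap_line, hkw, hk.self w hw] at h4
    linarith
  -- Both `c v` and `k w` vanish on `ρ`, so they are proportional, with negative factor. Near `x`
  -- one of the two is therefore nonnegative.
  have hprop : ∀ y, c v y = k w y * c v w := by
    intro y
    rw [hk.affineMap_apply (c v) y]
    refine Finset.sum_eq_single_of_mem w hw fun a ha hne => ?_
    rcases hu a ha with ha | h
    · rw [hc.ne v hv a (hρt ha) (fun h => hvρ (h ▸ ha)), mul_zero]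
    · exact absurd h hne
  have hcont : ∀ (f : E →ᵃ[ℝ] ℝ), 0 < f x → ∀ᶠ y in 𝓝 x, 0 < f y := fun f hf =>
    (f.continuous_of_finiteDimensional.tendsto x).eventually (lt_mem_nhds hf)
  rw [mem_interior_iff_mem_nhds]
  have hA := (Filter.eventually_all_finset ρ).2 fun a ha => hcont (c a) (hcx a ha)
  have hB := (Filter.eventually_all_finset ρ).2 fun a ha => hcont (k a) (hkx a ha)
  filter_upwards [hA, hB] with y hy1 hy2
  rcases le_total 0 (c v y) with h | h
  · left
    rw [hc.mem_hull]
    intro a ha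
    rcases ht a ha with ha | rfl
    exacts [(hy1 a ha).le, h]
  · right
    rw [hk.mem_hull]
    intro a ha
    rcases hu a ha with ha | rfl
    · exact (hy2 a ha).le
    · rw [hprop] at h
      nlinarith

theorem affineSpan_ne_top_of_card_le [FiniteDimensional ℝ E] (s : Finset E)
    (hs : s.card ≤ finrank ℝ E) : affineSpan ℝ (s : Set E) ≠ ⊤ := by
  intro h
  obtain ⟨t, hts, b, hb⟩ := AffineBasis.exists_affine_subbasis h
  have htf : t.Finite := s.finite_toSet.subset hts
  have := htf.fintype
  have h1 := b.card_eq_finrank_add_one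
  have h2 : Fintype.card t ≤ s.card := by
    rw [← Set.toFinset_card]
    exact Finset.card_le_card fun a ha => hts (by simpa using ha)
  omega

/-- A nonempty open set is not covered by countably many low-dimensional affine subspaces. -/
theorem exists_mem_open_notMem_affineSpan [FiniteDimensional ℝ E] {S : Set (Finset E)}
    (hS : S.Countable) (hcard : ∀ s ∈ S, s.card ≤ finrank ℝ E) {U : Set E} (hU : IsOpen U)
    (hne : U.Nonempty) : ∃ x ∈ U, ∀ s ∈ S, x ∉ affineSpan ℝ (s : Set E) := by
  have : CompleteSpace E := FiniteDimensional.complete ℝ E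
  have hd : Dense (⋂ s ∈ S, ((affineSpan ℝ (s : Set E) : Set E))ᶜ) := by
    refine dense_biInter_of_isOpen (fun s _ => ?_) hS fun s hs => ?_
    · exact (AffineSubspace.closed_of_finiteDimensional _).isOpen_compl
    · rw [← interior_eq_empty_iff_dense_compl]
      by_contra h
      have h := Set.nonempty_iff_ne_empty.2 h
      refine affineSpan_ne_top_of_card_le s (hcard s hs) (top_unique ?_)
      rw [← isOpen_interior.affineSpan_eq_top h]
      exact affineSpan_le.2 interior_subset
  obtain ⟨x, hx, hxU⟩ := hd.inter_open_nonempty U hU hne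
  exact ⟨x, hx, fun s hs => by simpa using Set.mem_iInter₂.1 hxU s hs⟩

end Simplex

/-! ### Cells and interiors of simplicial complexes -/

section Complex

variable {E : Type*} [NormedAddCommGroup E] [NormedSpace ℝ E]

theorem isCompact_convexHull_finset (s : Finset E) : IsCompact (convexHull ℝ (s : Set E)) :=
  s.finite_toSet.isCompact_convexHull ℝ

theorem isCompact_space {C : SimplicialComplex ℝ E} (hC : C.faces.Finite) : IsCompact C.space :=
  hC.isCompact_biUnion fun s _ => isCompact_convexHull_finset s

/-- Each simplex is closed, so the finitely many that miss `x` also miss a neighbourhood of it. This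
carries membership back from a perturbed point to `x`. -/
theorem eventually_mem_convexHull_imp {S : Set (Finset E)} (hS : S.Finite) (x : E) :
    ∀ᶠ y in 𝓝 x, ∀ s ∈ S, y ∈ convexHull ℝ (s : Set E) → x ∈ convexHull ℝ (s : Set E) := by
  rw [Filter.eventually_all_finite hS]
  intro s _
  by_cases h : x ∈ convexHull ℝ (s : Set E)
  · exact Eventually.of_forall fun _ _ => h
  · filter_upwards [(isCompact_convexHull_finset s).isClosed.isOpen_compl.mem_nhds h] with y hy hy'
    exact absurd hy' hy

theorem face_card_le [FiniteDimensional ℝ E] {K : SimplicialComplex ℝ E} {s : Finset E}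
    (hs : s ∈ K.faces) : s.card ≤ finrank ℝ E + 1 := by
  have h := (K.indep hs).card_le_finrank_succ
  have h2 := Submodule.finrank_le (vectorSpan ℝ (Set.range ((↑) : s → E)))
  simp only [Fintype.card_coe] at h
  omega

theorem finite_faces_of_isTriangulation {K : SimplicialComplex ℝ E} {P : Set E} (hP : P.Finite)
    (hK : IsTriangulation K P) : K.faces.Finite := by
  refine (hP.toFinset.powerset.finite_toSet).subset fun s hs => ?_
  simp only [Finset.coe_powerset, Set.mem_preimage, Set.mem_powerset_iff, Set.Finite.coe_toFinset]
  intro v hv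
  refine hK.vertices_subset ?_
  rw [SimplicialComplex.vertices_eq]
  exact Set.mem_biUnion hs hv

/-- A triangulation of a full-dimensional point set is covered by its full-dimensional cells. -/
theorem exists_cell_of_mem_convexHull [FiniteDimensional ℝ E] {n : ℕ} (hn : finrank ℝ E = n)
    {K : SimplicialComplex ℝ E} {P : Set E}
    (hP : P.Finite) (hK : IsTriangulation K P) (hint : (interior (convexHull ℝ P)).Nonempty)
    {x : E} (hx : x ∈ convexHull ℝ P) :
    ∃ σ : Cell K n, x ∈ convexHull ℝ (σ.1 : Set E) := by
  have hfin := finite_faces_of_isTriangulation hP hK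
  by_contra! hno
  have hev : ∀ᶠ y in 𝓝 x, ∀ σ : Cell K n, y ∉ convexHull ℝ (σ.1 : Set E) := by
    filter_upwards [eventually_mem_convexHull_imp hfin x] with y hy σ hσ
    exact hno σ (hy _ σ.2.1 hσ)
  obtain ⟨U, hU, hUo, hxU⟩ := eventually_nhds_iff.1 hev
  have hcl : x ∈ closure (interior (convexHull ℝ P)) := by
    rw [(convex_convexHull ℝ P).closure_interior_eq_closure_of_nonempty_interior hint]
    exact subset_closure hx
  -- A generic interior point near `x` avoids all lower-dimensional faces, so the face that contains
  -- it is a top cell.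
  obtain ⟨y, ⟨hyU, hyi⟩, hy⟩ := exists_mem_open_notMem_affineSpan
    (S := {s | s ∈ K.faces ∧ s.card ≤ finrank ℝ E}) (hfin.subset fun s hs => hs.1).countable
    (fun s hs => hs.2) (hUo.inter isOpen_interior) (mem_closure_iff.1 hcl U hUo hxU)
  have hyP := interior_subset hyi
  rw [← hK.space_eq, SimplicialComplex.mem_space_iff] at hyP
  obtain ⟨s, hs, hys⟩ := hyP
  have h1 : ¬ s.card ≤ finrank ℝ E := fun h => hy s ⟨hs, h⟩ (convexHull_subset_affineSpan _ hys)
  have h2 := face_card_le hs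
  exact hU y hyU ⟨s, hs, by omega⟩ hys

/-! ### Star bodies and their boundary facets -/

/-- A finite pure full-dimensional complex whose interior absorbs all proper contractions towards
the origin. -/
structure IsStarBody (C : SimplicialComplex ℝ E) : Prop where
  finite : C.faces.Finite
  pure : ∀ s ∈ C.faces, ∃ t ∈ C.faces, s ⊆ t ∧ t.card = finrank ℝ E + 1
  smul_mem : ∀ x ∈ C.space, ∀ r : ℝ, 0 ≤ r → r < 1 → r • x ∈ interior C.space

/-- A nonempty ball contains a full-dimensional simplex, so its intrinsic interior is its interior
and strict star-shapedness becomes the contraction property. The empty complex satisfies everything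
vacuously. -/
theorem isStarBody_of_mem_starBalls [FiniteDimensional ℝ E] {n : ℕ} (hn : finrank ℝ E = n)
    {K C : SimplicialComplex ℝ E} (hK : K.faces.Finite) (hC : C ∈ starBalls K n) :
    IsStarBody C := by
  obtain ⟨hle, rfl | ⟨hball, h0, hstar⟩⟩ := hC
  · refine ⟨by simp [SimplicialComplex.faces_bot], by simp [SimplicialComplex.faces_bot],
      by simp [SimplicialComplex.space_bot]⟩
  · have hpure : ∀ s ∈ C.faces, ∃ t ∈ C.faces, s ⊆ t ∧ t.card = finrank ℝ E + 1 := by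
      rw [hn]; exact hball.pure
    refine ⟨hK.subset hle, hpure, ?_⟩
    have htop : affineSpan ℝ C.space = ⊤ := by
      obtain ⟨s, hs, h0s⟩ := SimplicialComplex.mem_space_iff.1 h0
      obtain ⟨t, ht, -, hcard⟩ := hpure s hs
      have h1 : affineSpan ℝ (t : Set E) = ⊤ := by
        have := (C.indep ht).affineSpan_eq_top_iff_card_eq_finrank_add_one
        rw [Subtype.range_coe_subtype] at this
        exact this.2 (by simpa using hcard)
      exact top_unique (h1 ▸ affineSpan_mono ℝ (SimplicialComplex.subset_space ht))
    have hint : intrinsicInterior ℝ C.space ⊆ interior C.space := by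
      refine interior_maximal intrinsicInterior_subset ?_
      refine IsOpen.isOpenMap_subtype_val ?_ _ isOpen_interior
      rw [htop]
      exact isOpen_univ
    replace hstar := fun y hy => (hstar y hy).trans (Set.union_subset_union_left _ hint)
    intro x hx r hr0 hr1
    have key : ∀ y ∈ C.space, y ≠ 0 → ∀ r : ℝ, 0 ≤ r → r < 1 → r • y ∈ interior C.space := by
      intro y hy hy0 r hr0 hr1
      have hmem : r • y ∈ segment ℝ 0 y :=
        ⟨1 - r, r, by linarith, hr0, by ring, by simp⟩
      rcases hstar y hy hmem with h | h
      · exact h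
      · exfalso
        have : (1 - r) • y = 0 := by
          rw [sub_smul, one_smul, Set.mem_singleton_iff.1 h, sub_self]
        rcases smul_eq_zero.1 this with h | h
        · linarith
        · exact hy0 h
    -- Star-shapedness says nothing for the degenerate segment at the origin. There one contracts
    -- another point by the factor `0`; if there is none, the ambient space is a point.
    rcases eq_or_ne x 0 with rfl | hx0
    · rw [smul_zero]
      by_cases hsub : ∃ y ∈ C.space, y ≠ 0
      · obtain ⟨y, hy, hy0⟩ := hsub
        simpa using key y hy hy0 0 le_rfl one_pos
      · push Not at hsub
        have hS : C.space = {0} := Set.eq_singleton_iff_unique_mem.2 ⟨h0, hsub⟩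
        have : (Set.univ : Set E) = {0} := by
          rw [hS] at htop
          rw [← AffineSubspace.coe_affineSpan_singleton ℝ E (0 : E), htop,
            AffineSubspace.top_coe]
        rw [hS, ← this]
        simp
    · exact key x hx hx0 r hr0 hr1

/-- The simplices `t` and `u` meet in the hull of their common vertices, so a vertex of `t` missing
from `u` has coordinate `0` at `x`. -/
theorem interior_subset_face {K : SimplicialComplex ℝ E} {t u : Finset E} {c : E → E →ᵃ[ℝ] ℝ}
    (hc : IsCoord t c) (ht : t ∈ K.faces) (hu : u ∈ K.faces) {ρ : Finset E} (hρt : ρ ⊆ t) {x : E}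
    (hx : ∀ a ∈ ρ, 0 < c a x) (hxt : x ∈ convexHull ℝ (t : Set E))
    (hxu : x ∈ convexHull ℝ (u : Set E)) : ρ ⊆ u := by
  intro a ha
  by_contra hau
  have := hc.eq_zero_of_mem_convexHull Set.inter_subset_left
    (K.inter_subset_convexHull ht hu ⟨hxt, hxu⟩) (hρt ha) (fun h => hau h.2)
  exact (hx a ha).ne' this

/-- A full-dimensional cell meeting the interior of a subcomplex belongs to the subcomplex. -/
theorem mem_faces_of_mem_interior_space [FiniteDimensional ℝ E] {K C : SimplicialComplex ℝ E}
    (hle : C ≤ K) {t : Finset E} (ht : t ∈ K.faces) (hcard : t.card = finrank ℝ E + 1) {x : E}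
    (hx : x ∈ convexHull ℝ (t : Set E)) (hxi : x ∈ interior C.space) : t ∈ C.faces := by
  obtain ⟨c, hc⟩ := exists_isCoord (K.indep ht) hcard
  obtain ⟨y, hyC, hyt⟩ := mem_closure_iff.1 (hc.closure_interior hx) _ isOpen_interior hxi
  obtain ⟨u, hu, hyu⟩ := SimplicialComplex.mem_space_iff.1 (interior_subset hyC)
  exact C.down_closed hu (interior_subset_face hc ht (hle hu) subset_rfl
    ((hc.mem_interior y).1 hyt) (interior_subset hyt) hyu) (K.nonempty_of_mem_faces ht)

theorem IsCoord.centroid_pos {t ρ : Finset E} {c : E → E →ᵃ[ℝ] ℝ} (hc : IsCoord t c)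
    (hρt : ρ ⊆ t) (hne : ρ.Nonempty) :
    ∃ g ∈ convexHull ℝ (ρ : Set E), ∀ a ∈ ρ, 0 < c a g := by
  have hpos : 0 < (ρ.card : ℝ) := by exact_mod_cast hne.card_pos
  have hsum : ∑ _v ∈ ρ, (ρ.card : ℝ)⁻¹ = 1 := by simp [hpos.ne']
  refine ⟨∑ v ∈ ρ, (ρ.card : ℝ)⁻¹ • v, ?_, fun a ha => ?_⟩
  · rw [Finset.mem_convexHull']
    exact ⟨fun _ => (ρ.card : ℝ)⁻¹, fun _ _ => by positivity, hsum, rfl⟩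
  · rw [affineMap_sum _ _ (fun _ => (ρ.card : ℝ)⁻¹) hsum]
    refine Finset.sum_pos' (fun w hw => ?_) ⟨a, ha, ?_⟩
    · rcases eq_or_ne a w with rfl | h
      · rw [hc.self _ (hρt ha)]; positivity
      · rw [hc.ne a (hρt ha) w (hρt hw) h]; simp
    · rw [hc.self _ (hρt ha)]; positivity

theorem eventually_line_mem {U : Set E} (hU : IsOpen U) {x : E} (hx : x ∈ U) (y : E) :
    ∀ᶠ r in 𝓝[>] (0 : ℝ), x + r • (y - x) ∈ U := by
  have hcont : Continuous fun r : ℝ => x + r • (y - x) := by fun_prop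
  have := (hcont.tendsto 0).mono_left (nhdsWithin_le_nhds (s := Set.Ioi 0))
  exact this.eventually (hU.mem_nhds (by simpa using hx))

/-- Boundary facets do not meet the interior. -/
theorem IsStarBody.notMem_interior_of_mem_boundaryFacets [FiniteDimensional ℝ E] {n : ℕ}
    (hn : finrank ℝ E = n) {C : SimplicialComplex ℝ E} (hC : IsStarBody C) {ρ : Finset E}
    (hρ : ρ ∈ boundaryFacets C n) {x : E} (hx : x ∈ convexHull ℝ (ρ : Set E)) :
    x ∉ interior C.space := by
  intro hxi
  obtain ⟨hρcard, t, ⟨ht, htcard, hρt⟩, huniq⟩ := hρ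
  obtain ⟨c, hc⟩ := exists_isCoord (C.indep ht) (hn ▸ htcard)
  have hne : ρ.Nonempty := by
    by_contra h
    simp [Finset.not_nonempty_iff_eq_empty.1 h] at hx
  obtain ⟨g, hg, hgpos⟩ := hc.centroid_pos hρt hne
  obtain ⟨v, hv, hvρ⟩ : ∃ v ∈ t, v ∉ ρ := Finset.exists_mem_notMem_of_card_lt_card (by omega)
  have h1 : ∀ᶠ r in 𝓝[>] (0 : ℝ), r < 1 := nhdsWithin_le_nhds (gt_mem_nhds one_pos)
  obtain ⟨r, ⟨hr, hr1⟩, hr0⟩ :=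
    (((eventually_line_mem isOpen_interior hxi g).and h1).and self_mem_nhdsWithin).exists
  have hr0' : 0 < r := hr0
  -- Pushing `x` towards the centroid makes it a relative interior point of `ρ` while keeping it in
  -- the interior of the body.
  set y := x + r • (g - x) with hy
  have hyρ : y ∈ convexHull ℝ (ρ : Set E) :=
    (convex_convexHull ℝ _).add_smul_sub_mem hx hg ⟨hr0'.le, hr1.le⟩
  have hyt : y ∈ convexHull ℝ (t : Set E) := convexHull_mono (by exact_mod_cast hρt) hyρ
  have hxt : x ∈ convexHull ℝ (t : Set E) := convexHull_mono (by exact_mod_cast hρt) hx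
  have hypos : ∀ a ∈ ρ, 0 < c a y := by
    intro a ha
    rw [hy, affineMap_line]
    have := (hc.mem_hull x).1 hxt a (hρt ha)
    have := hgpos a ha
    nlinarith
  clear_value y
  have hyv : c v y = 0 :=
    hc.eq_zero_of_mem_convexHull (by exact_mod_cast hρt) hyρ hv (by simpa)
  obtain ⟨U, hU, hUo, hyU⟩ := eventually_nhds_iff.1 (eventually_mem_convexHull_imp hC.finite y)
  -- Leave `t` through `ρ`, moving away from `v`. The cell met there contains `ρ`, hence is `t` by
  -- uniqueness, but the coordinate at `v` has become negative.
  obtain ⟨q, ⟨hqU, hqi⟩, hq0⟩ := ((eventually_line_mem (hUo.inter isOpen_interior) ⟨hyU, hr⟩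
    (y + (y - v))).and self_mem_nhdsWithin).exists
  obtain ⟨u, hu, hqu⟩ := SimplicialComplex.mem_space_iff.1 (interior_subset hqi)
  obtain ⟨u', hu', huu', hu'card⟩ := hC.pure u hu
  have hqu' := convexHull_mono (𝕜 := ℝ) (Finset.coe_subset.2 huu') hqu
  have hρu' := interior_subset_face hc ht hu' hρt hypos hyt (hU _ hqU u' hu' hqu')
  obtain rfl := huniq u' ⟨hu', hn ▸ hu'card, hρu'⟩
  have h2 : y + (y - v) = y + (-1 : ℝ) • (v - y) := by module
  have h3 := (hc.mem_hull _).1 hqu' v hv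
  rw [affineMap_line, h2, affineMap_line, hyv, hc.self v hv] at h3
  have hq0' : 0 < q := hq0
  linarith

/-- Every non-interior point lies on a boundary facet. -/
theorem IsStarBody.exists_boundaryFacet [FiniteDimensional ℝ E] {n : ℕ}
    (hn : finrank ℝ E = n) {C : SimplicialComplex ℝ E} (hC : IsStarBody C) {x : E}
    (hx : x ∈ C.space) (hxi : x ∉ interior C.space) :
    ∃ ρ ∈ boundaryFacets C n, x ∈ convexHull ℝ (ρ : Set E) := by
  classical
  by_contra! hno
  have hfin : (boundaryFacets C n).Finite := by
    refine (hC.finite.biUnion fun t _ => t.powerset.finite_toSet).subset ?_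
    rintro ρ ⟨-, t, ⟨ht, -, hρt⟩, -⟩
    exact Set.mem_biUnion ht (by simpa using hρt)
  have hev : ∀ᶠ y in 𝓝 x, ∀ ρ ∈ boundaryFacets C n, y ∉ convexHull ℝ (ρ : Set E) := by
    filter_upwards [eventually_mem_convexHull_imp hfin x] with y hy ρ hρ h
    exact hno ρ hρ (hy ρ hρ h)
  obtain ⟨ε, hε, hball⟩ := Metric.eventually_nhds_iff_ball.1 hev
  have hxε : x ∈ Metric.ball x ε := Metric.mem_ball_self hε
  have hSc : IsClosed C.space := (isCompact_space hC.finite).isClosed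
  obtain ⟨a, haε, hai⟩ : ∃ a ∈ Metric.ball x ε, a ∈ interior C.space := by
    have h1 : ∀ᶠ r in 𝓝[>] (0 : ℝ), r ≤ 1 := nhdsWithin_le_nhds (ge_mem_nhds one_pos)
    obtain ⟨r, ⟨hr, hr1⟩, hr0⟩ :=
      (((eventually_line_mem Metric.isOpen_ball hxε 0).and h1).and self_mem_nhdsWithin).exists
    have hr0' : 0 < r := hr0
    refine ⟨_, hr, ?_⟩
    have : x + r • (0 - x) = (1 - r) • x := by module
    rw [this]
    exact hC.smul_mem x hx _ (by linarith) (by linarith)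
  have hout : (Metric.ball x ε ∩ C.spaceᶜ).Nonempty := by
    by_contra h
    rw [Set.not_nonempty_iff_eq_empty, ← Set.disjoint_iff_inter_eq_empty,
      Set.disjoint_compl_right_iff_subset] at h
    exact hxi (mem_interior.2 ⟨_, h, Metric.isOpen_ball, hxε⟩)
  -- Join an interior point `a` to an exterior point `b` chosen off every span of `a` with a face of
  -- codimension at least two, so that the segment leaves the body through the relative interior of
  -- a facet.
  obtain ⟨b, ⟨hbε, hbS⟩, hb⟩ := exists_mem_open_notMem_affineSpan
    (S := (insert a) '' {s | s ∈ C.faces ∧ s.card < n})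
    ((hC.finite.subset fun s hs => hs.1).image _).countable
    (by
      rintro _ ⟨s, ⟨-, hs⟩, rfl⟩
      have := Finset.card_insert_le a s
      omega) (Metric.isOpen_ball.inter hSc.isOpen_compl) hout
  let γ : ℝ → E := fun r => a + r • (b - a)
  have hγ : Continuous γ := by fun_prop
  have hT : IsCompact (Set.Icc (0 : ℝ) 1 ∩ γ ⁻¹' C.space) :=
    isCompact_Icc.inter_right (hSc.preimage hγ)
  -- `θ` is the last parameter at which the segment is in the body.
  obtain ⟨θ, ⟨⟨hθ0, hθ1⟩, hθS⟩, hmax⟩ := hT.exists_isMaxOn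
    ⟨0, ⟨le_rfl, zero_le_one⟩, by simpa [γ] using interior_subset hai⟩ continuousOn_id
  have hθ1' : θ < 1 := by
    refine lt_of_le_of_ne hθ1 ?_
    rintro rfl
    exact hbS (by simpa [γ] using hθS)
  have hci : γ θ ∉ interior C.space := by
    intro h
    have h1 : ∀ᶠ r in 𝓝[>] θ, γ r ∈ interior C.space :=
      nhdsWithin_le_nhds (hγ.continuousAt.eventually (isOpen_interior.mem_nhds h))
    have h2 : ∀ᶠ r in 𝓝[>] θ, r ≤ 1 := nhdsWithin_le_nhds (ge_mem_nhds hθ1')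
    obtain ⟨r, ⟨hr, hr1⟩, hr0⟩ := ((h1.and h2).and self_mem_nhdsWithin).exists
    have hr0' : θ < r := hr0
    have : r ≤ θ := hmax ⟨⟨by linarith, hr1⟩, interior_subset (s := C.space) hr⟩
    linarith
  have hθ0' : 0 < θ := by
    refine lt_of_le_of_ne hθ0 ?_
    rintro rfl
    exact hci (by simpa [γ] using hai)
  have hcε : γ θ ∈ Metric.ball x ε :=
    (convex_ball x ε).add_smul_sub_mem haε hbε ⟨hθ0, hθ1⟩
  have hgen : ∀ s ∈ C.faces, s.card < n → γ θ ∉ convexHull ℝ (s : Set E) := by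
    intro s hs hcard h
    refine hb _ ⟨s, ⟨hs, hcard⟩, rfl⟩ ?_
    have h1 : a ∈ affineSpan ℝ ((insert a s : Finset E) : Set E) :=
      subset_affineSpan _ _ (by simp)
    have h2 : γ θ ∈ affineSpan ℝ ((insert a s : Finset E) : Set E) :=
      affineSpan_mono ℝ (by simp) (convexHull_subset_affineSpan _ h)
    have h3 := AffineMap.lineMap_mem θ⁻¹ h1 h2
    have h4 : AffineMap.lineMap a (γ θ) θ⁻¹ = b := by
      simp [γ, AffineMap.lineMap_apply, smul_smul, hθ0'.ne']
    rwa [h4] at h3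
  obtain ⟨s, hs, hcs⟩ := SimplicialComplex.mem_space_iff.1 hθS
  obtain ⟨t, ht, hst, htcard⟩ := hC.pure s hs
  have hct := convexHull_mono (𝕜 := ℝ) (Finset.coe_subset.2 hst) hcs
  obtain ⟨c, hc⟩ := exists_isCoord (C.indep ht) htcard
  obtain ⟨v, hv, hcv⟩ := hc.exists_erase_of_notMem_interior hct
    (fun h => hci (interior_mono (SimplicialComplex.convexHull_subset_space ht) h))
  set ρ := t.erase v with hρ
  have hρcard : ρ.card = n := by rw [hρ, Finset.card_erase_of_mem hv]; omega
  have hρt : ρ ⊆ t := Finset.erase_subset _ _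
  have hρne : ρ.Nonempty := by
    by_contra h
    simp [Finset.not_nonempty_iff_eq_empty.1 h] at hcv
  -- The ball around `x` misses all boundary facets, so `ρ` has a second cell `u`. Then `t ∪ u` is a
  -- neighbourhood of the exit point, which is absurd.
  obtain ⟨u, hu, hucard, hρu, hut⟩ : ∃ u ∈ C.faces, u.card = n + 1 ∧ ρ ⊆ u ∧ u ≠ t := by
    by_contra! hall
    exact hball _ hcε ρ ⟨hρcard, t, ⟨ht, by omega, hρt⟩, fun u hu => hall u hu.1 hu.2.1 hu.2.2⟩ hcv
  obtain ⟨k, hk⟩ := exists_isCoord (C.indep hu) (by omega)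
  obtain ⟨w, hw, hwρ⟩ : ∃ w ∈ u, w ∉ ρ := Finset.exists_mem_notMem_of_card_lt_card (by omega)
  have huw : insert w ρ = u := Finset.eq_of_subset_of_card_le
    (Finset.insert_subset hw hρu) (by rw [Finset.card_insert_of_notMem hwρ]; omega)
  have htv : insert v ρ = t := Finset.insert_erase hv
  have hvρ : v ∉ ρ := Finset.notMem_erase _ _
  have hpos : ∀ (r : Finset E) (m : E → E →ᵃ[ℝ] ℝ), IsCoord r m → ρ ⊆ r → ∀ a ∈ ρ,
      0 < m a (γ θ) := by
    intro r m hm hρr a ha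
    have hcr := convexHull_mono (𝕜 := ℝ) (Finset.coe_subset.2 hρr) hcv
    refine lt_of_le_of_ne ((hm.mem_hull _).1 hcr a (hρr ha)) fun h => ?_
    have h1 : γ θ ∈ convexHull ℝ (ρ.erase a : Set E) := by
      refine hm.mem_convexHull_of_eq_zero ((Finset.erase_subset _ _).trans hρr)
        (fun z hz => (hm.mem_hull _).1 hcr z (hρr (Finset.mem_of_mem_erase hz))) fun z hz hza => ?_
      by_cases hzρ : z ∈ ρ
      · have : z = a := by
          by_contra hne
          exact hza (Finset.mem_erase.2 ⟨hne, hzρ⟩)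
        rw [this, ← h]
      · exact hm.eq_zero_of_mem_convexHull (by exact_mod_cast hρr) hcv hz (by simpa using hzρ)
    rcases (ρ.erase a).eq_empty_or_nonempty with he | he
    · simp [he] at h1
    · refine hgen _ (C.down_closed ht ((Finset.erase_subset _ _).trans hρt) he) ?_ h1
      have := Finset.card_erase_lt_of_mem ha
      omega
  have hinter : convexHull ℝ (t : Set E) ∩ convexHull ℝ (u : Set E) ⊆
      convexHull ℝ (ρ : Set E) := by
    refine (C.inter_subset_convexHull ht hu).trans (convexHull_mono ?_)
    rintro z ⟨hzt, hzu⟩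
    by_contra hzρ
    have h1 : z = v := by
      rw [← htv] at hzt
      simpa [show z ∉ ρ by simpa using hzρ] using hzt
    have h2 : z = w := by
      rw [← huw] at hzu
      simpa [show z ∉ ρ by simpa using hzρ] using hzu
    exact hut (by rw [← huw, ← htv, ← h1, ← h2])
  have hfinal := mem_interior_union_of_common_facet hc hk hρt hρu hv hvρ hw hwρ
    (fun z hz => by rw [← htv] at hz; simpa [or_comm] using hz)
    (fun z hz => by rw [← huw] at hz; simpa [or_comm] using hz) hinter hcv (hpos t c hc hρt)
    (hpos u k hk hρu)
  exact hci (interior_mono (Set.union_subset (SimplicialComplex.convexHull_subset_space ht)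
    (SimplicialComplex.convexHull_subset_space hu)) hfinal)

/-- A nonempty compact set in a positive-dimensional space is not open, so some point of it is not
interior. In dimension zero the boundary facet is the empty simplex of the single cell `{0}`. -/
theorem IsStarBody.boundaryFacets_nonempty [FiniteDimensional ℝ E] {n : ℕ}
    (hn : finrank ℝ E = n) {C : SimplicialComplex ℝ E} (hC : IsStarBody C)
    (hne : C.faces.Nonempty) : (boundaryFacets C n).Nonempty := by
  obtain ⟨s, hs⟩ := hne
  rcases subsingleton_or_nontrivial E with hsub | hnon
  · have h0 : finrank ℝ E = 0 := finrank_zero_of_subsingleton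
    have hcard : ∀ u ∈ C.faces, u = {0} := fun u hu => by
      obtain ⟨a, ha⟩ := C.nonempty_of_mem_faces hu
      ext z
      simp [Subsingleton.elim z a, Subsingleton.elim 0 a, ha]
    refine ⟨∅, by simp [← hn, h0], {0}, ⟨hcard s hs ▸ hs, by simp [← hn, h0], by simp⟩,
      fun u hu => hcard u hu.1⟩
  · obtain ⟨a, ha⟩ := C.nonempty_of_mem_faces hs
    have haS : a ∈ C.space := SimplicialComplex.subset_space hs ha
    have hcomp := isCompact_space hC.finite
    have hx : ∃ x ∈ C.space, x ∉ interior C.space := by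
      by_contra! h
      have hopen : IsOpen C.space := interior_eq_iff_isOpen.1
        (interior_subset.antisymm h)
      have huniv := IsClopen.eq_univ ⟨hcomp.isClosed, hopen⟩ ⟨a, haS⟩
      have : NoncompactSpace E := NormedSpace.noncompactSpace ℝ E
      exact noncompact_univ E (huniv ▸ hcomp)
    obtain ⟨x, hx, hxi⟩ := hx
    obtain ⟨ρ, hρ, -⟩ := hC.exists_boundaryFacet hn hx hxi
    exact ⟨ρ, hρ⟩

/-- The vertices of a boundary facet are linearly independent. -/
theorem IsStarBody.eq_zero_of_sum_smul_eq_zero [FiniteDimensional ℝ E] {n : ℕ}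
    (hn : finrank ℝ E = n) {C : SimplicialComplex ℝ E} (hC : IsStarBody C) {ρ : Finset E}
    (hρ : ρ ∈ boundaryFacets C n) {b : E → ℝ} (hb : ∑ a ∈ ρ, b a • a = 0) :
    ∀ a ∈ ρ, b a = 0 := by
  have hρ' := hρ
  obtain ⟨hρcard, t, ⟨ht, htcard, hρt⟩, -⟩ := hρ'
  by_cases hB : ∑ a ∈ ρ, b a = 0
  · exact ((C.indep ht).mono (Finset.coe_subset.2 hρt)).eq_zero_of_sum_eq_zero_subtype hB hb
  -- Normalising the coefficients puts `0` in the affine span of `ρ`. The centroid, contracted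
  -- slightly, then stays in `ρ` and also lies in the interior of the body.
  · exfalso
    obtain ⟨c, hc⟩ := exists_isCoord (C.indep ht) (hn ▸ htcard)
    have hne : ρ.Nonempty := by
      by_contra h
      simp [Finset.not_nonempty_iff_eq_empty.1 h] at hB
    obtain ⟨g, hg, hgpos⟩ := hc.centroid_pos hρt hne
    have hzero : ∀ v ∈ t, v ∉ ρ → c v 0 = 0 := by
      intro v hv hvρ
      have h1 : ∑ a ∈ ρ, (∑ a ∈ ρ, b a)⁻¹ * b a = 1 := by
        rw [← Finset.mul_sum, inv_mul_cancel₀ hB]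
      have h2 := affineMap_sum (c v) ρ _ h1
      simp_rw [mul_smul, ← Finset.smul_sum, hb, smul_zero] at h2
      rw [h2]
      refine Finset.sum_eq_zero fun a ha => ?_
      rw [hc.ne v hv a (hρt ha) (fun h => hvρ (h ▸ ha)), mul_zero]
    have hev : ∀ᶠ r in 𝓝[>] (0 : ℝ), ∀ a ∈ ρ, 0 < c a (g + r • (0 - g)) := by
      refine (Filter.eventually_all_finset ρ).2 fun a ha => ?_
      have hopen : IsOpen {x | 0 < c a x} :=
        isOpen_lt continuous_const (c a).continuous_of_finiteDimensional
      exact eventually_line_mem hopen (hgpos a ha) 0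
    have h1 : ∀ᶠ r in 𝓝[>] (0 : ℝ), r ≤ 1 := nhdsWithin_le_nhds (ge_mem_nhds one_pos)
    obtain ⟨r, ⟨hr, hr1⟩, hr0⟩ := ((hev.and h1).and self_mem_nhdsWithin).exists
    have hr0' : 0 < r := hr0
    have hmem : g + r • (0 - g) ∈ convexHull ℝ (ρ : Set E) := by
      refine hc.mem_convexHull_of_eq_zero hρt (fun a ha => (hr a ha).le)
        fun v hv hvρ => ?_
      rw [affineMap_line, hzero v hv hvρ,
        hc.eq_zero_of_mem_convexHull (by exact_mod_cast hρt) hg hv (by simpa using hvρ)]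
      simp
    refine hC.notMem_interior_of_mem_boundaryFacets hn hρ hmem ?_
    have : g + r • (0 - g) = (1 - r) • g := by module
    rw [this]
    refine hC.smul_mem g ?_ _ (by linarith) (by linarith)
    exact SimplicialComplex.convexHull_subset_space ht
      (convexHull_mono (by exact_mod_cast hρt) hg)

end Complex

/-! ### Free sums of point sets and simplices -/

section FreeSum

variable {E F : Type*} [NormedAddCommGroup E] [NormedSpace ℝ E]
  [NormedAddCommGroup F] [NormedSpace ℝ F]

theorem mem_freeSum {P : Set E} {Q : Set F} {z : E × F} :
    z ∈ freeSum P Q ↔ (z.1 ∈ P ∧ z.2 = 0) ∨ (z.1 = 0 ∧ z.2 ∈ Q) := by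
  simp [freeSum, Set.mem_prod]

theorem freeSum_mono {P P' : Set E} {Q Q' : Set F} (hP : P ⊆ P') (hQ : Q ⊆ Q') :
    freeSum P Q ⊆ freeSum P' Q' :=
  Set.union_subset_union (Set.prod_mono_left hP) (Set.prod_mono_right hQ)

theorem freeSum_inter_subset (P P' : Set E) (Q Q' : Set F) :
    freeSum (P ∩ P') (Q ∩ Q') ⊆ freeSum P Q ∩ freeSum P' Q' :=
  Set.subset_inter (freeSum_mono Set.inter_subset_left Set.inter_subset_left)
    (freeSum_mono Set.inter_subset_right Set.inter_subset_right)

theorem coe_sumCell (σ : Finset E) (τ : Finset F) :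
    (sumCell σ τ : Set (E × F)) = freeSum (σ : Set E) (τ : Set F) := by
  ext ⟨x, y⟩
  simp only [sumCell, Finset.coe_union, Finset.coe_image, Set.mem_union, Set.mem_image,
    Finset.mem_coe, Prod.mk.injEq, mem_freeSum]
  aesop

theorem freeSum_eq_image (P : Set E) (Q : Set F) :
    freeSum P Q = LinearMap.inl ℝ E F '' P ∪ LinearMap.inr ℝ E F '' Q := by
  ext ⟨x, y⟩
  simp only [mem_freeSum, Set.mem_union, Set.mem_image, LinearMap.inl_apply, LinearMap.inr_apply,
    Prod.mk.injEq]
  aesop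

/-- The conditional hypotheses allow an empty factor at `r = 0` or `r = 1`, where it has weight
zero. -/
theorem mk_mem_convexHull_freeSum {P : Set E} {Q : Set F} {r : ℝ} (h0 : 0 ≤ r) (h1 : r ≤ 1)
    {p : E} {q : F} (hp : r ≠ 0 → p ∈ convexHull ℝ P) (hq : r ≠ 1 → q ∈ convexHull ℝ Q) :
    (r • p, (1 - r) • q) ∈ convexHull ℝ (freeSum P Q) := by
  rw [freeSum_eq_image]
  have hP : r ≠ 0 → (p, (0 : F)) ∈
      convexHull ℝ (LinearMap.inl ℝ E F '' P ∪ LinearMap.inr ℝ E F '' Q) := fun h => by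
    refine convexHull_mono Set.subset_union_left ?_
    rw [← LinearMap.image_convexHull]
    exact ⟨p, hp h, rfl⟩
  have hQ : r ≠ 1 → ((0 : E), q) ∈
      convexHull ℝ (LinearMap.inl ℝ E F '' P ∪ LinearMap.inr ℝ E F '' Q) := fun h => by
    refine convexHull_mono Set.subset_union_right ?_
    rw [← LinearMap.image_convexHull]
    exact ⟨q, hq h, rfl⟩
  by_cases hr0 : r = 0
  · subst hr0
    simpa using hQ (by norm_num)
  by_cases hr1 : r = 1
  · subst hr1
    simpa using hP (by norm_num)
  · simpa using convex_convexHull ℝ _ (hP hr0) (hQ hr1) h0 (by linarith : 0 ≤ 1 - r) (by ring)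

theorem exists_of_mem_convexHull_freeSum {P : Set E} {Q : Set F} {z : E × F}
    (hz : z ∈ convexHull ℝ (freeSum P Q)) :
    ∃ (r : ℝ) (p : E) (q : F), 0 ≤ r ∧ r ≤ 1 ∧ z = (r • p, (1 - r) • q) ∧
      (r ≠ 0 → p ∈ convexHull ℝ P) ∧ (r ≠ 1 → q ∈ convexHull ℝ Q) := by
  rw [freeSum_eq_image] at hz
  rcases P.eq_empty_or_nonempty with rfl | hP
  · rw [Set.image_empty, Set.empty_union, ← LinearMap.image_convexHull] at hz
    obtain ⟨q, hq, rfl⟩ := hz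
    exact ⟨0, 0, q, le_rfl, zero_le_one, by simp, by simp, fun _ => hq⟩
  rcases Q.eq_empty_or_nonempty with rfl | hQ
  · rw [Set.image_empty, Set.union_empty, ← LinearMap.image_convexHull] at hz
    obtain ⟨p, hp, rfl⟩ := hz
    exact ⟨1, p, 0, zero_le_one, le_rfl, by simp, fun _ => hp, by simp⟩
  rw [convexHull_union (hP.image _) (hQ.image _), mem_convexJoin] at hz
  obtain ⟨a, ha, b, hb, u, v, hu, hv, huv, rfl⟩ := hz
  rw [← LinearMap.image_convexHull] at ha hb
  obtain ⟨p, hp, rfl⟩ := ha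
  obtain ⟨q, hq, rfl⟩ := hb
  refine ⟨u, p, q, hu, by linarith, ?_, fun _ => hp, fun _ => hq⟩
  rw [← huv]
  simp

theorem zero_notMem_of_eq_zero {τ : Finset F}
    (hτ : ∀ b : F → ℝ, ∑ y ∈ τ, b y • y = 0 → ∀ y ∈ τ, b y = 0) : (0 : F) ∉ τ := by
  classical
  intro h
  have := hτ (fun y => if y = 0 then 1 else 0) (Finset.sum_eq_zero fun y _ => by
    by_cases hy : y = 0 <;> simp [hy]) 0 h
  simp at this

theorem sum_sumCell {M : Type*} [AddCommMonoid M] {σ : Finset E} {τ : Finset F}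
    (h : (0 : E) ∉ σ ∨ (0 : F) ∉ τ) (f : E × F → M) :
    ∑ z ∈ sumCell σ τ, f z = ∑ x ∈ σ, f (x, 0) + ∑ y ∈ τ, f (0, y) := by
  classical
  unfold sumCell
  rw [Finset.sum_union, Finset.sum_image (by simp), Finset.sum_image (by simp)]
  rw [Finset.disjoint_left]
  rintro ⟨x, y⟩ hz hz'
  simp only [Finset.mem_image, Prod.mk.injEq] at hz hz'
  obtain ⟨a, ha, rfl, rfl⟩ := hz
  obtain ⟨b, hb, rfl, rfl⟩ := hz'
  tauto

theorem card_sumCell {σ : Finset E} {τ : Finset F} (h : (0 : E) ∉ σ ∨ (0 : F) ∉ τ) :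
    (sumCell σ τ).card = σ.card + τ.card := by
  simp only [Finset.card_eq_sum_ones]
  exact sum_sumCell h _

theorem affineIndependent_of_sum_eq_zero {V : Type*} [AddCommGroup V] [Module ℝ V] {s : Finset V}
    (h : ∀ w : V → ℝ, ∑ x ∈ s, w x = 0 → ∑ x ∈ s, w x • x = 0 → ∀ x ∈ s, w x = 0) :
    AffineIndependent ℝ ((↑) : s → V) := by
  classical
  rw [affineIndependent_iff_of_fintype]
  intro w hw hw' i
  rw [Finset.weightedVSub_eq_linear_combination _ hw] at hw'
  let W : V → ℝ := fun x => if hx : x ∈ s then w ⟨x, hx⟩ else 0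
  have hW : ∀ i : s, W i = w i := fun i => by simp [W]
  rw [← hW]
  refine h W ?_ ?_ i i.2
  · rw [← Finset.sum_coe_sort]
    simpa [hW] using hw
  · rw [← Finset.sum_coe_sort s (fun x => W x • x)]
    simpa [hW] using hw'

/-- An affine dependence splits into one linear relation per factor, coupled only through the total
weight. If `0` lay in both factors, the two copies of it would coincide. -/
theorem affineIndependent_sumCell {σ : Finset E} {τ : Finset F}
    (h0 : (0 : E) ∉ σ ∨ (0 : F) ∉ τ)
    (h : ∀ (a : E → ℝ) (b : F → ℝ), ∑ x ∈ σ, a x + ∑ y ∈ τ, b y = 0 → ∑ x ∈ σ, a x • x = 0 →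
      ∑ y ∈ τ, b y • y = 0 → (∀ x ∈ σ, a x = 0) ∧ ∀ y ∈ τ, b y = 0) :
    AffineIndependent ℝ ((↑) : sumCell σ τ → E × F) := by
  refine affineIndependent_of_sum_eq_zero fun w hw hw' => ?_
  rw [sum_sumCell h0] at hw hw'
  have h1 := congrArg Prod.fst hw'
  have h2 := congrArg Prod.snd hw'
  simp only [Prod.smul_mk, smul_zero, Prod.fst_add, Prod.snd_add, Prod.fst_sum, Prod.snd_sum,
    Finset.sum_const_zero, add_zero, zero_add, Prod.fst_zero, Prod.snd_zero] at h1 h2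
  obtain ⟨ha, hb⟩ := h (fun x => w (x, 0)) (fun y => w (0, y)) hw h1 h2
  intro z hz
  rw [← Finset.mem_coe, coe_sumCell, mem_freeSum] at hz
  obtain ⟨x, y⟩ := z
  rcases hz with ⟨hx, rfl⟩ | ⟨rfl, hy⟩
  exacts [ha x hx, hb y hy]

end FreeSum

/-! ### Compatible pairs and intersections of sum cells -/

section Webs

variable {E F : Type*} [NormedAddCommGroup E] [NormedSpace ℝ E]
  [NormedAddCommGroup F] [NormedSpace ℝ F]
  {d e : ℕ} {KP : SimplicialComplex ℝ E} {KQ : SimplicialComplex ℝ F}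
  {α : Cell KP d → SimplicialComplex ℝ F} {β : Cell KQ e → SimplicialComplex ℝ E}

/-- Two compatible families of star bodies in full-dimensional complexes with star-shaped
supports. -/
structure IsCompatiblePair (α : Cell KP d → SimplicialComplex ℝ F)
    (β : Cell KQ e → SimplicialComplex ℝ E) : Prop where
  finrank_left : finrank ℝ E = d
  finrank_right : finrank ℝ F = e
  finite_left : KP.faces.Finite
  finite_right : KQ.faces.Finite
  cover_left : ∀ x ∈ KP.space, ∃ σ : Cell KP d, x ∈ convexHull ℝ (σ.1 : Set E)
  cover_right : ∀ y ∈ KQ.space, ∃ τ : Cell KQ e, y ∈ convexHull ℝ (τ.1 : Set F)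
  smul_left : ∀ x ∈ KP.space, ∀ r : ℝ, 0 ≤ r → r < 1 → r • x ∈ interior KP.space
  smul_right : ∀ y ∈ KQ.space, ∀ r : ℝ, 0 ≤ r → r < 1 → r • y ∈ interior KQ.space
  le_left : ∀ σ, α σ ≤ KQ
  le_right : ∀ τ, β τ ≤ KP
  body_left : ∀ σ, IsStarBody (α σ)
  body_right : ∀ τ, IsStarBody (β τ)
  compat : ∀ (σ : Cell KP d) (τ : Cell KQ e), σ.1 ∈ (β τ).faces ↔ τ.1 ∉ (α σ).faces

/-- Negating the compatibility condition exchanges the roles of `α` and `β`, so every result about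
one factor also holds for the other. -/
theorem IsCompatiblePair.symm (h : IsCompatiblePair α β) : IsCompatiblePair β α :=
  ⟨h.2, h.1, h.4, h.3, h.6, h.5, h.8, h.7, h.10, h.9, h.12, h.11, fun τ σ => by
    rw [h.compat σ τ, not_not]⟩

/-- The factors of the cells in `sumCells α β`. -/
def IsFactorPair (α : Cell KP d → SimplicialComplex ℝ F) (β : Cell KQ e → SimplicialComplex ℝ E)
    (s : Finset E) (r : Finset F) : Prop :=
  (∃ σ : Cell KP d, s = σ.1 ∧ r ∈ boundaryFacets (α σ) e) ∨
    ∃ τ : Cell KQ e, r = τ.1 ∧ s ∈ boundaryFacets (β τ) d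

theorem IsFactorPair.symm {s : Finset E} {r : Finset F} (h : IsFactorPair α β s r) :
    IsFactorPair β α r s :=
  Or.symm h

/-- The condition `β τ ≠ ⊥` is automatic, since the empty complex has no boundary facets; this makes
the description symmetric. -/
theorem mem_sumCells {c : Finset (E × F)} :
    c ∈ sumCells α β ↔ ∃ s r, IsFactorPair α β s r ∧ c = sumCell s r := by
  constructor
  · rintro (⟨σ, ρ, hρ, rfl⟩ | ⟨τ, -, ρ, hρ, rfl⟩)
    exacts [⟨_, _, Or.inl ⟨σ, rfl, hρ⟩, rfl⟩, ⟨_, _, Or.inr ⟨τ, rfl, hρ⟩, rfl⟩]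
  · rintro ⟨s, r, ⟨σ, rfl, hr⟩ | ⟨τ, rfl, hs⟩, rfl⟩
    · exact Or.inl ⟨σ, r, hr, rfl⟩
    · refine Or.inr ⟨τ, fun h => ?_, s, hs, rfl⟩
      obtain ⟨-, t, ⟨ht, -⟩, -⟩ := hs
      rw [h, SimplicialComplex.faces_bot] at ht
      exact ht

theorem IsFactorPair.exists_left (h : IsCompatiblePair α β) {s : Finset E} {r : Finset F}
    (hsr : IsFactorPair α β s r) : ∃ σ : Cell KP d, s ⊆ σ.1 := by
  rcases hsr with ⟨σ, rfl, -⟩ | ⟨τ, -, -, t, ⟨ht, hcard, hst⟩, -⟩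
  exacts [⟨σ, subset_rfl⟩, ⟨⟨t, h.le_right τ ht, hcard⟩, hst⟩]

theorem IsFactorPair.exists_right (h : IsCompatiblePair α β) {s : Finset E} {r : Finset F}
    (hsr : IsFactorPair α β s r) : ∃ τ : Cell KQ e, r ⊆ τ.1 :=
  hsr.symm.exists_left h.symm

theorem Cell.subset_space (σ : Cell KP d) : convexHull ℝ (σ.1 : Set E) ⊆ KP.space :=
  SimplicialComplex.convexHull_subset_space σ.2.1

theorem IsFactorPair.left_subset_space (h : IsCompatiblePair α β) {s : Finset E} {r : Finset F}
    (hsr : IsFactorPair α β s r) : convexHull ℝ (s : Set E) ⊆ KP.space := by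
  obtain ⟨σ, hσ⟩ := hsr.exists_left h
  exact (convexHull_mono (Finset.coe_subset.2 hσ)).trans (Cell.subset_space σ)

theorem IsFactorPair.inter_left (h : IsCompatiblePair α β) {s₁ s₂ : Finset E}
    {r₁ r₂ : Finset F} (h₁ : IsFactorPair α β s₁ r₁) (h₂ : IsFactorPair α β s₂ r₂) {p : E}
    (hp₁ : p ∈ convexHull ℝ (s₁ : Set E)) (hp₂ : p ∈ convexHull ℝ (s₂ : Set E)) :
    p ∈ convexHull ℝ (s₁ ∩ s₂ : Set E) := by
  have key : ∀ {s r}, IsFactorPair α β s r → p ∈ convexHull ℝ (s : Set E) → s ∈ KP.faces := by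
    intro s r hsr hp
    obtain ⟨σ, hσ⟩ := hsr.exists_left h
    refine KP.down_closed σ.2.1 hσ ?_
    by_contra hne
    simp [Finset.not_nonempty_iff_eq_empty.1 hne] at hp
  exact KP.inter_subset_convexHull (key h₁ hp₁) (key h₂ hp₂) ⟨hp₁, hp₂⟩

variable [FiniteDimensional ℝ E] [FiniteDimensional ℝ F]

/-- Linear independence of `ρ` kills `b`; what remains is an affine relation in the simplex `σ`. -/
theorem IsCompatiblePair.sumCell_aux (h : IsCompatiblePair α β) {σ : Cell KP d} {ρ : Finset F}
    (hρ : ρ ∈ boundaryFacets (α σ) e) : (0 : F) ∉ ρ ∧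
    ∀ (a : E → ℝ) (b : F → ℝ), ∑ x ∈ σ.1, a x + ∑ y ∈ ρ, b y = 0 → ∑ x ∈ σ.1, a x • x = 0 →
      ∑ y ∈ ρ, b y • y = 0 → (∀ x ∈ σ.1, a x = 0) ∧ ∀ y ∈ ρ, b y = 0 := by
  have key := fun b => (h.body_left σ).eq_zero_of_sum_smul_eq_zero h.finrank_right hρ (b := b)
  refine ⟨zero_notMem_of_eq_zero key, fun a b hab ha hb => ?_⟩
  have hb' := key b hb
  rw [Finset.sum_eq_zero hb', add_zero] at hab
  exact ⟨(KP.indep σ.2.1).eq_zero_of_sum_eq_zero_subtype hab ha, hb'⟩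

theorem IsFactorPair.affineIndependent (h : IsCompatiblePair α β) {s : Finset E} {r : Finset F}
    (hsr : IsFactorPair α β s r) : AffineIndependent ℝ ((↑) : sumCell s r → E × F) := by
  rcases hsr with ⟨σ, rfl, hr⟩ | ⟨τ, rfl, hs⟩
  · obtain ⟨h0, h1⟩ := h.sumCell_aux hr
    exact affineIndependent_sumCell (Or.inr h0) h1
  · obtain ⟨h0, h1⟩ := h.symm.sumCell_aux hs
    exact affineIndependent_sumCell (Or.inl h0) fun a b hab ha hb =>
      (h1 b a (by rwa [add_comm]) hb ha).symm

theorem IsFactorPair.card_sumCell (h : IsCompatiblePair α β) {s : Finset E} {r : Finset F}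
    (hsr : IsFactorPair α β s r) : (sumCell s r).card = d + e + 1 := by
  rcases hsr with ⟨σ, rfl, hr⟩ | ⟨τ, rfl, hs⟩
  · rw [FreeSumWebs.card_sumCell (Or.inr (h.sumCell_aux hr).1), σ.2.2, hr.1]
    ring
  · rw [FreeSumWebs.card_sumCell (Or.inl (h.symm.sumCell_aux hs).1), τ.2.2, hs.1]
    ring

/-- A point of the first factor of a cell that is interior to the support lies in a
full-dimensional simplex `σ` such that `α σ` contains a simplex above the second factor. -/
theorem IsFactorPair.exists_mem_left (h : IsCompatiblePair α β) {s : Finset E} {r : Finset F}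
    (hsr : IsFactorPair α β s r) {p : E} (hp : p ∈ convexHull ℝ (s : Set E))
    (hpi : p ∈ interior KP.space) :
    ∃ (σ : Cell KP d) (τ : Cell KQ e), τ.1 ∈ (α σ).faces ∧ p ∈ convexHull ℝ (σ.1 : Set E) ∧
      r ⊆ τ.1 := by
  rcases hsr with ⟨σ, rfl, -, t, ⟨ht, hcard, hrt⟩, -⟩ | ⟨τ, rfl, hs⟩
  · exact ⟨σ, ⟨t, h.le_left σ ht, hcard⟩, ht, hp, hrt⟩
  -- Otherwise every cell around `p` would belong to `β τ`, making `p` interior to it, although `p`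
  -- lies on a boundary facet.
  · by_contra! hno
    refine (h.body_right τ).notMem_interior_of_mem_boundaryFacets h.finrank_left hs hp ?_
    rw [mem_interior_iff_mem_nhds]
    filter_upwards [eventually_mem_convexHull_imp h.finite_left p,
      isOpen_interior.mem_nhds hpi] with x hx hxi
    obtain ⟨σ, hσ⟩ := h.cover_left x (interior_subset hxi)
    have hσβ : σ.1 ∈ (β τ).faces := by
      rw [h.compat]
      exact fun hτ => hno σ τ hτ (hx _ σ.2.1 hσ) subset_rfl
    exact SimplicialComplex.convexHull_subset_space hσβ hσ

/-- Moving inwards in the first and outwards in the second factor, one cannot enter a product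
`σ × τ` with `τ ∈ α σ` from a product with `τ ∉ α σ`. -/
theorem IsCompatiblePair.no_crossing (h : IsCompatiblePair α β) {σ₁ σ₂ : Cell KP d}
    {τ₁ τ₂ : Cell KQ e} (h₁ : σ₁.1 ∈ (β τ₁).faces) (h₂ : τ₂.1 ∈ (α σ₂).faces) {p : E} {q : F}
    {a b : ℝ} (ha0 : 0 ≤ a) (ha1 : a < 1) (hb0 : 0 ≤ b) (hb1 : b < 1)
    (hp₁ : p ∈ convexHull ℝ (σ₁.1 : Set E)) (hp₂ : a • p ∈ convexHull ℝ (σ₂.1 : Set E))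
    (hq₂ : q ∈ convexHull ℝ (τ₂.1 : Set F)) (hq₁ : b • q ∈ convexHull ℝ (τ₁.1 : Set F)) :
    False := by
  have hp := (h.body_right τ₁).smul_mem p
    (SimplicialComplex.convexHull_subset_space h₁ hp₁) a ha0 ha1
  have hq := (h.body_left σ₂).smul_mem q
    (SimplicialComplex.convexHull_subset_space h₂ hq₂) b hb0 hb1
  have h3 := mem_faces_of_mem_interior_space (h.le_right τ₁) σ₂.2.1
    (by rw [h.finrank_left]; exact σ₂.2.2) hp₂ hp
  have h4 := mem_faces_of_mem_interior_space (h.le_left σ₂) τ₁.2.1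
    (by rw [h.finrank_right]; exact τ₁.2.2) hq₁ hq
  exact (h.compat σ₂ τ₁).1 h3 h4

/-- If `l < m`, the point at `l` lies in a β-labelled product and the one at `m` in an α-labelled
one, which `no_crossing` forbids. Strict contraction makes the inner points `p₂` and `q₁` interior
to the supports. -/
theorem IsCompatiblePair.not_lt_of_mem (h : IsCompatiblePair α β) {s₁ s₂ : Finset E}
    {r₁ r₂ : Finset F} (h₁ : IsFactorPair α β s₁ r₁) (h₂ : IsFactorPair α β s₂ r₂) {l m : ℝ}
    (hl : 0 ≤ l) (hm : m ≤ 1) {p₁ p₂ : E} {q₁ q₂ : F} (hp : l • p₁ = m • p₂)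
    (hq : (1 - l) • q₁ = (1 - m) • q₂) (hp₁ : l ≠ 0 → p₁ ∈ convexHull ℝ (s₁ : Set E))
    (hq₁ : l ≠ 1 → q₁ ∈ convexHull ℝ (r₁ : Set F)) (hp₂ : m ≠ 0 → p₂ ∈ convexHull ℝ (s₂ : Set E))
    (hq₂ : m ≠ 1 → q₂ ∈ convexHull ℝ (r₂ : Set F)) : ¬ l < m := by
  intro hlm
  have hm0 : 0 < m := hl.trans_lt hlm
  have hl1 : 0 < 1 - l := by linarith
  replace hp₂ := hp₂ hm0.ne'
  replace hq₁ := hq₁ (by linarith)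
  have ha0 : 0 ≤ l / m := by positivity
  have ha1 : l / m < 1 := (div_lt_one hm0).2 hlm
  have hb0 : 0 ≤ (1 - m) / (1 - l) := div_nonneg (by linarith) hl1.le
  have hb1 : (1 - m) / (1 - l) < 1 := (div_lt_one hl1).2 (by linarith)
  have hpe : p₂ = (l / m) • p₁ := by
    rw [div_eq_inv_mul, mul_smul, hp, smul_smul, inv_mul_cancel₀ hm0.ne', one_smul]
  have hqe : q₁ = ((1 - m) / (1 - l)) • q₂ := by
    rw [div_eq_inv_mul, mul_smul, ← hq, smul_smul, inv_mul_cancel₀ hl1.ne', one_smul]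
  have hpi : p₂ ∈ interior KP.space := by
    by_cases hl0 : l = 0
    · have : p₂ = (0 : ℝ) • p₂ := by rw [hpe, hl0]; simp
      rw [this]
      exact h.smul_left _ (h₂.left_subset_space h hp₂) 0 le_rfl one_pos
    · rw [hpe]
      exact h.smul_left _ (h₁.left_subset_space h (hp₁ hl0)) _ ha0 ha1
  have hqi : q₁ ∈ interior KQ.space := by
    by_cases hm1 : m = 1
    · have : q₁ = (0 : ℝ) • q₁ := by rw [hqe, hm1]; simp
      rw [this]
      exact h.smul_right _ (h₁.symm.left_subset_space h.symm hq₁) 0 le_rfl one_pos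
    · rw [hqe]
      exact h.smul_right _ (h₂.symm.left_subset_space h.symm (hq₂ hm1)) _ hb0 hb1
  obtain ⟨σ₂, τ₂, hτσ, hpσ₂, hrτ₂⟩ := h₂.exists_mem_left h hp₂ hpi
  obtain ⟨τ₁, σ₁, hστ, hqτ₁, hsσ₁⟩ := h₁.symm.exists_mem_left h.symm hq₁ hqi
  -- For `l = 0` the point `p₁` is unconstrained; any point of `σ₁` serves, as it is scaled by `0`.
  obtain ⟨p, hpσ₁, hpp⟩ : ∃ p ∈ convexHull ℝ (σ₁.1 : Set E), p₂ = (l / m) • p := by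
    by_cases hl0 : l = 0
    · obtain ⟨p, hpσ⟩ := KP.nonempty_of_mem_faces σ₁.2.1
      exact ⟨p, subset_convexHull _ _ hpσ, by rw [hpe, hl0]; simp⟩
    · exact ⟨p₁, convexHull_mono (Finset.coe_subset.2 hsσ₁) (hp₁ hl0), hpe⟩
  obtain ⟨q, hqτ₂, hqq⟩ : ∃ q ∈ convexHull ℝ (τ₂.1 : Set F), q₁ = ((1 - m) / (1 - l)) • q := by
    by_cases hm1 : m = 1
    · obtain ⟨q, hqτ⟩ := KQ.nonempty_of_mem_faces τ₂.2.1
      exact ⟨q, subset_convexHull _ _ hqτ, by rw [hqe, hm1]; simp⟩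
    · exact ⟨q₂, convexHull_mono (Finset.coe_subset.2 hrτ₂) (hq₂ hm1), hqe⟩
  exact h.no_crossing hστ hτσ ha0 ha1 hb0 hb1 hpσ₁ (hpp ▸ hpσ₂) hqτ₂ (hqq ▸ hqτ₁)

theorem IsCompatiblePair.inter_sumCell (h : IsCompatiblePair α β) {s₁ s₂ : Finset E}
    {r₁ r₂ : Finset F} (h₁ : IsFactorPair α β s₁ r₁) (h₂ : IsFactorPair α β s₂ r₂) :
    convexHull ℝ (sumCell s₁ r₁ : Set (E × F)) ∩ convexHull ℝ (sumCell s₂ r₂ : Set (E × F)) ⊆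
      convexHull ℝ (sumCell s₁ r₁ ∩ sumCell s₂ r₂ : Set (E × F)) := by
  rintro z ⟨hz₁, hz₂⟩
  rw [coe_sumCell] at hz₁ hz₂
  obtain ⟨l, p₁, q₁, hl0, hl1, rfl, hp₁, hq₁⟩ := exists_of_mem_convexHull_freeSum hz₁
  obtain ⟨m, p₂, q₂, hm0, hm1, hz, hp₂, hq₂⟩ := exists_of_mem_convexHull_freeSum hz₂
  obtain ⟨hp, hq⟩ := Prod.mk.inj hz
  have hlm : l = m := le_antisymm
    (not_lt.1 (h.not_lt_of_mem h₂ h₁ hm0 hl1 hp.symm hq.symm hp₂ hq₂ hp₁ hq₁))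
    (not_lt.1 (h.not_lt_of_mem h₁ h₂ hl0 hm1 hp hq hp₁ hq₁ hp₂ hq₂))
  subst hlm
  rw [coe_sumCell, coe_sumCell]
  refine convexHull_mono (freeSum_inter_subset _ _ _ _)
    (mk_mem_convexHull_freeSum hl0 hl1 (fun hl => ?_) fun hl => ?_)
  · have : p₁ = p₂ := smul_right_injective E hl hp
    exact h₁.inter_left h h₂ (hp₁ hl) (this ▸ hp₂ hl)
  · have : q₁ = q₂ := smul_right_injective F (sub_ne_zero.2 (Ne.symm hl)) hq
    exact h₁.symm.inter_left h.symm h₂.symm (hq₁ hl) (this ▸ hq₂ hl)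

end Webs

/-! ### Covering the free sum -/

section Cover

variable {E F : Type*} [NormedAddCommGroup E] [NormedSpace ℝ E] [FiniteDimensional ℝ E]
  [NormedAddCommGroup F] [NormedSpace ℝ F] [FiniteDimensional ℝ F]
  {d e : ℕ} {KP : SimplicialComplex ℝ E} {KQ : SimplicialComplex ℝ F}
  {α : Cell KP d → SimplicialComplex ℝ F} {β : Cell KQ e → SimplicialComplex ℝ E}

/-- The decompositions `z = (l p, (1 - l) q)` with `p` and `q` in the supports. -/
def decompositions (KP : SimplicialComplex ℝ E) (KQ : SimplicialComplex ℝ F) (z : E × F) :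
    Set (ℝ × E × F) :=
  (Set.Icc 0 1 ×ˢ KP.space ×ˢ KQ.space) ∩ {w | (w.1 • w.2.1, (1 - w.1) • w.2.2) = z}

theorem isCompact_decompositions (h : IsCompatiblePair α β) (z : E × F) :
    IsCompact (decompositions KP KQ z) := by
  refine (isCompact_Icc.prod ((isCompact_space h.finite_left).prod
    (isCompact_space h.finite_right))).inter_right ?_
  exact isClosed_eq (by fun_prop) continuous_const

theorem mem_decompositions {z : E × F} {l : ℝ} {p : E} {q : F} :
    (l, p, q) ∈ decompositions KP KQ z ↔
      (0 ≤ l ∧ l ≤ 1) ∧ p ∈ KP.space ∧ q ∈ KQ.space ∧ (l • p, (1 - l) • q) = z := by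
  simp only [decompositions, Set.mem_inter_iff, Set.mem_prod, Set.mem_Icc, Set.mem_ofPred_eq]
  tauto

/-- Changing the parameter of a decomposition. -/
theorem rescale_eq {l m : ℝ} (hm0 : m ≠ 0) (hm1 : m ≠ 1) (p : E) (q : F) :
    (m • (l / m) • p, (1 - m) • ((1 - l) / (1 - m)) • q) = (l • p, (1 - l) • q) := by
  rw [smul_smul, smul_smul, mul_div_cancel₀ _ hm0, mul_div_cancel₀ _ (sub_ne_zero.2 hm1.symm)]

theorem tendsto_div_smul {l : ℝ} (hl : l ≠ 0) (p : E) :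
    Tendsto (fun m : ℝ => (l / m) • p) (𝓝 l) (𝓝 p) := by
  have : ContinuousAt (fun m : ℝ => (l / m) • p) l :=
    (continuousAt_const.div continuousAt_id hl).smul continuousAt_const
  simpa [ContinuousAt, div_self hl] using this

theorem tendsto_one_sub_div_smul {l : ℝ} (hl : l ≠ 1) (q : F) :
    Tendsto (fun m : ℝ => ((1 - l) / (1 - m)) • q) (𝓝 l) (𝓝 q) := by
  have h1 := sub_ne_zero.2 hl.symm
  have : Tendsto (fun m : ℝ => 1 - m) (𝓝 l) (𝓝 (1 - l)) :=
    (continuous_const.sub continuous_id).tendsto l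
  exact (tendsto_div_smul h1 q).comp this

theorem IsCompatiblePair.boundary_nonempty_right (h : IsCompatiblePair α β) {σ : Cell KP d}
    {τ : Cell KQ e} (hσ : σ.1 ∈ (β τ).faces) : ∃ s, IsFactorPair α β s τ.1 := by
  obtain ⟨s, hs⟩ := (h.body_right τ).boundaryFacets_nonempty h.finrank_left ⟨_, hσ⟩
  exact ⟨s, Or.inr ⟨τ, rfl, hs⟩⟩

theorem IsCompatiblePair.boundary_nonempty_left (h : IsCompatiblePair α β) {σ : Cell KP d}
    {τ : Cell KQ e} (hτ : τ.1 ∈ (α σ).faces) : ∃ r, IsFactorPair α β σ.1 r := by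
  obtain ⟨r, hr⟩ := h.symm.boundary_nonempty_right hτ
  exact ⟨r, hr.symm⟩

theorem mem_convexHull_sumCell {s : Finset E} {r : Finset F} {l : ℝ} (hl0 : 0 ≤ l) (hl1 : l ≤ 1)
    {p : E} {q : F} (hp : l ≠ 0 → p ∈ convexHull ℝ (s : Set E))
    (hq : l ≠ 1 → q ∈ convexHull ℝ (r : Set F)) :
    (l • p, (1 - l) • q) ∈ convexHull ℝ (sumCell s r : Set (E × F)) := by
  rw [coe_sumCell]
  exact mk_mem_convexHull_freeSum hl0 hl1 hp hq

/-- If no decomposition lies in a product `σ × τ` with `τ ∈ α σ`, then the innermost one lies on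
the boundary of some `β τ`. -/
theorem IsCompatiblePair.exists_factorPair_of_forall (h : IsCompatiblePair α β) {z : E × F}
    (hne : (decompositions KP KQ z).Nonempty)
    (hall : ∀ w ∈ decompositions KP KQ z, ∀ (σ : Cell KP d) (τ : Cell KQ e),
      w.2.1 ∈ convexHull ℝ (σ.1 : Set E) → w.2.2 ∈ convexHull ℝ (τ.1 : Set F) →
      τ.1 ∉ (α σ).faces) :
    ∃ s r, IsFactorPair α β s r ∧ z ∈ convexHull ℝ (sumCell s r : Set (E × F)) := by
  -- Minimal `l` puts `p` as far out as possible: were `p` interior to `β τ`, a smaller `l` would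
  -- still give a decomposition.
  obtain ⟨⟨l, p, q⟩, hw, hmin⟩ :=
    (isCompact_decompositions h z).exists_isMinOn hne continuous_fst.continuousOn
  obtain ⟨⟨hl0, hl1⟩, hp, hq, rfl⟩ := mem_decompositions.1 hw
  obtain ⟨σ, hσ⟩ := h.cover_left p hp
  obtain ⟨τ, hτ⟩ := h.cover_right q hq
  have hσβ : σ.1 ∈ (β τ).faces := (h.compat σ τ).2 (hall _ hw σ τ hσ hτ)
  by_cases hl : l = 0
  · obtain ⟨s, hs⟩ := h.boundary_nonempty_right hσβ
    exact ⟨s, τ.1, hs, mem_convexHull_sumCell hl0 hl1 (fun h => absurd hl h) fun _ => hτ⟩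
  · have hl' : 0 < l := lt_of_le_of_ne hl0 (Ne.symm hl)
    have hpi : p ∉ interior (β τ).space := by
      intro hpi
      have hle : (β τ).space ⊆ KP.space :=
        Set.biUnion_subset_biUnion_left (h.le_right τ)
      have h1 : ∀ᶠ m in 𝓝[<] l, (l / m) • p ∈ interior (β τ).space :=
        nhdsWithin_le_nhds ((tendsto_div_smul hl p).eventually (isOpen_interior.mem_nhds hpi))
      have h2 : ∀ᶠ m in 𝓝[<] l, 0 < m := nhdsWithin_le_nhds (lt_mem_nhds hl')
      obtain ⟨m, ⟨hm, hm0⟩, hml⟩ := ((h1.and h2).and self_mem_nhdsWithin).exists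
      have hml' : m < l := hml
      have hq' : ((1 - l) / (1 - m)) • q ∈ KQ.space :=
        interior_subset (h.smul_right q hq _ (div_nonneg (by linarith) (by linarith))
          ((div_lt_one (by linarith)).2 (by linarith)))
      have : l ≤ m := hmin (mem_decompositions.2 ⟨⟨hm0.le, by linarith⟩,
        hle (interior_subset hm), hq', rescale_eq hm0.ne' (by linarith) p q⟩)
      linarith
    obtain ⟨ρ, hρ, hpρ⟩ := (h.body_right τ).exists_boundaryFacet h.finrank_left
      (SimplicialComplex.convexHull_subset_space hσβ hσ) hpi
    exact ⟨ρ, τ.1, Or.inr ⟨τ, rfl, hρ⟩,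
      mem_convexHull_sumCell hl0 hl1 (fun _ => hpρ) fun _ => hτ⟩

/-- If some decomposition lies in a product `σ × τ` with `τ ∈ α σ`, then the outermost one gives a
cell containing the point. -/
theorem IsCompatiblePair.exists_factorPair_of_exists (h : IsCompatiblePair α β) {z : E × F}
    (hex : ∃ w ∈ decompositions KP KQ z, ∃ (σ : Cell KP d) (τ : Cell KQ e),
      w.2.1 ∈ convexHull ℝ (σ.1 : Set E) ∧ w.2.2 ∈ convexHull ℝ (τ.1 : Set F) ∧
      τ.1 ∈ (α σ).faces) :
    ∃ s r, IsFactorPair α β s r ∧ z ∈ convexHull ℝ (sumCell s r : Set (E × F)) := by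
  have : Finite (Cell KP d) := (h.finite_left.subset fun s hs => hs.1).to_subtype
  have : Finite (Cell KQ e) := (h.finite_right.subset fun s hs => hs.1).to_subtype
  -- The α-labelled region is a finite union of closed products, so a largest `l` is attained on it.
  have hclosed : IsClosed (⋃ στ : {στ : Cell KP d × Cell KQ e // στ.2.1 ∈ (α στ.1).faces},
      {w : ℝ × E × F | w.2.1 ∈ convexHull ℝ (στ.1.1.1 : Set E) ∧
        w.2.2 ∈ convexHull ℝ (στ.1.2.1 : Set F)}) := by
    refine isClosed_iUnion_of_finite fun στ => ?_
    exact ((isCompact_convexHull_finset _).isClosed.preimage (by fun_prop)).inter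
      ((isCompact_convexHull_finset _).isClosed.preimage (by fun_prop))
  obtain ⟨⟨l, p, q⟩, ⟨hw, hwG⟩, hmax⟩ :=
    ((isCompact_decompositions h z).inter_right hclosed).exists_isMaxOn (by
      obtain ⟨w, hw, σ, τ, hσ, hτ, hτσ⟩ := hex
      exact ⟨w, hw, Set.mem_iUnion.2 ⟨⟨(σ, τ), hτσ⟩, hσ, hτ⟩⟩) continuous_fst.continuousOn
  obtain ⟨⟨⟨σ, τ⟩, hτσ⟩, hσ, hτ⟩ := Set.mem_iUnion.1 hwG
  obtain ⟨⟨hl0, hl1⟩, hp, hq, rfl⟩ := mem_decompositions.1 hw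
  dsimp only at hσ hτ hτσ
  by_cases hl : l = 1
  · obtain ⟨r, hr⟩ := h.boundary_nonempty_left hτσ
    exact ⟨σ.1, r, hr, mem_convexHull_sumCell hl0 hl1 (fun _ => hσ) fun h => absurd hl h⟩
  have hl' : l < 1 := lt_of_le_of_ne hl1 hl
  by_cases hqi : q ∈ interior (α σ).space
  swap
  · obtain ⟨ρ, hρ, hqρ⟩ := (h.body_left σ).exists_boundaryFacet h.finrank_right
      (SimplicialComplex.convexHull_subset_space hτσ hτ) hqi
    exact ⟨σ.1, ρ, Or.inl ⟨σ, rfl, hρ⟩,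
      mem_convexHull_sumCell hl0 hl1 (fun _ => hσ) fun _ => hqρ⟩
  -- With `q` interior to `α σ`, raise `l` slightly. By maximality the new product `σ' × τ'` is
  -- β-labelled, while `τ' ∈ α σ`. So `σ ∉ β τ'` although `σ' ∈ β τ'`, which for `l ≠ 0` puts `p`,
  -- lying in both cells, on the boundary of `β τ'`.
  have h1 : ∀ᶠ m in 𝓝[>] l, ((1 - l) / (1 - m)) • q ∈ interior (α σ).space ∧
      ∀ u ∈ KQ.faces, ((1 - l) / (1 - m)) • q ∈ convexHull ℝ (u : Set F) →
        q ∈ convexHull ℝ (u : Set F) :=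
    nhdsWithin_le_nhds ((tendsto_one_sub_div_smul hl q).eventually
      ((isOpen_interior.eventually_mem hqi).and (eventually_mem_convexHull_imp h.finite_right q)))
  have h2 : ∀ᶠ m in 𝓝[>] l, l ≠ 0 → ∀ u ∈ KP.faces, (l / m) • p ∈ convexHull ℝ (u : Set E) →
      p ∈ convexHull ℝ (u : Set E) := by
    by_cases hl0 : l = 0
    · exact Eventually.of_forall fun _ h => absurd hl0 h
    · filter_upwards [nhdsWithin_le_nhds ((tendsto_div_smul hl0 p).eventually
        (eventually_mem_convexHull_imp h.finite_left p))] with m hm _ using hm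
  have h3 : ∀ᶠ m in 𝓝[>] l, m < 1 := nhdsWithin_le_nhds (gt_mem_nhds hl')
  obtain ⟨m, ⟨⟨⟨hmi, hmq⟩, hmp⟩, hm1⟩, hlm⟩ :=
    (((h1.and h2).and h3).and self_mem_nhdsWithin).exists
  have hlm' : l < m := hlm
  have hm0 : 0 < m := by linarith
  have hp' : (l / m) • p ∈ KP.space := interior_subset (h.smul_left p hp _ (by positivity)
    ((div_lt_one hm0).2 hlm'))
  have hle : (α σ).space ⊆ KQ.space := Set.biUnion_subset_biUnion_left (h.le_left σ)
  have hq' := hle (interior_subset hmi)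
  obtain ⟨σ', hσ'⟩ := h.cover_left _ hp'
  obtain ⟨τ', hτ'⟩ := h.cover_right _ hq'
  have hσβ : σ'.1 ∈ (β τ').faces := by
    rw [h.compat]
    intro hmem
    have : m ≤ l := hmax ⟨mem_decompositions.2 ⟨⟨hm0.le, hm1.le⟩, hp', hq',
      rescale_eq hm0.ne' hm1.ne p q⟩, Set.mem_iUnion.2 ⟨⟨(σ', τ'), hmem⟩, hσ', hτ'⟩⟩
    linarith
  have hτ'α : τ'.1 ∈ (α σ).faces := mem_faces_of_mem_interior_space (h.le_left σ) τ'.2.1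
    (by rw [h.finrank_right]; exact τ'.2.2) hτ' hmi
  have hqτ' := hmq _ τ'.2.1 hτ'
  by_cases hl0' : l = 0
  · obtain ⟨s, hs⟩ := h.boundary_nonempty_right hσβ
    exact ⟨s, τ'.1, hs, mem_convexHull_sumCell hl0 hl1 (fun h => absurd hl0' h) fun _ => hqτ'⟩
  · have hpσ' := hmp hl0' _ σ'.2.1 hσ'
    have hpi : p ∉ interior (β τ').space := fun hpi =>
      (h.compat σ τ').1 (mem_faces_of_mem_interior_space (h.le_right τ') σ.2.1
        (by rw [h.finrank_left]; exact σ.2.2) hσ hpi) hτ'α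
    obtain ⟨ρ, hρ, hpρ⟩ := (h.body_right τ').exists_boundaryFacet h.finrank_left
      (SimplicialComplex.convexHull_subset_space hσβ hpσ') hpi
    exact ⟨ρ, τ'.1, Or.inr ⟨τ', rfl, hρ⟩,
      mem_convexHull_sumCell hl0 hl1 (fun _ => hpρ) fun _ => hqτ'⟩

theorem IsCompatiblePair.exists_factorPair (h : IsCompatiblePair α β) {z : E × F}
    (hne : (decompositions KP KQ z).Nonempty) :
    ∃ s r, IsFactorPair α β s r ∧ z ∈ convexHull ℝ (sumCell s r : Set (E × F)) := by
  by_cases hex : ∃ w ∈ decompositions KP KQ z, ∃ (σ : Cell KP d) (τ : Cell KQ e),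
      w.2.1 ∈ convexHull ℝ (σ.1 : Set E) ∧ w.2.2 ∈ convexHull ℝ (τ.1 : Set F) ∧
      τ.1 ∈ (α σ).faces
  · exact h.exists_factorPair_of_exists hex
  · push Not at hex
    exact h.exists_factorPair_of_forall hne hex

/-! ### The resulting triangulation -/

/-- The simplicial complex generated by the cells `sumCells α β`. -/
def IsCompatiblePair.complex (h : IsCompatiblePair α β) : SimplicialComplex ℝ (E × F) where
  faces := {s | s.Nonempty ∧ ∃ t ∈ sumCells α β, s ⊆ t}
  isRelLowerSet_faces := by
    rintro s ⟨hs, t, ht, hst⟩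
    exact ⟨hs, fun u hu hne => ⟨hne, t, ht, hu.trans hst⟩⟩
  indep := by
    rintro s ⟨-, t, ht, hst⟩
    obtain ⟨a, b, hab, rfl⟩ := mem_sumCells.1 ht
    exact (hab.affineIndependent h).mono (Finset.coe_subset.2 hst)
  inter_subset_convexHull := by
    classical
    rintro s s' ⟨-, t, ht, hst⟩ ⟨-, t', ht', hst'⟩ z ⟨hz, hz'⟩
    obtain ⟨a, b, hab, rfl⟩ := mem_sumCells.1 ht
    obtain ⟨a', b', hab', rfl⟩ := mem_sumCells.1 ht'
    have hmem := h.inter_sumCell hab hab' ⟨convexHull_mono (Finset.coe_subset.2 hst) hz,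
      convexHull_mono (Finset.coe_subset.2 hst') hz'⟩
    rw [← Finset.coe_inter] at hmem
    -- Inside the first cell, intersect `s` with the common face of the two cells; then, inside the
    -- second, intersect the result with `s'`.
    have h1 := (hab.affineIndependent h).convexHull_inter hst
      (Finset.inter_subset_left (s₁ := sumCell a b) (s₂ := sumCell a' b'))
    replace h1 := h1.ge ⟨hz, hmem⟩
    have h2 : z ∈ convexHull ℝ ((s ∩ sumCell a' b' : Finset (E × F)) : Set (E × F)) := by
      refine convexHull_mono ?_ h1
      rintro y ⟨hy, hy'⟩
      simp only [Finset.coe_inter, Set.mem_inter_iff, Finset.mem_coe] at hy hy' ⊢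
      exact ⟨hy, hy'.2⟩
    have h3 := (hab'.affineIndependent h).convexHull_inter
      (Finset.inter_subset_right (s₁ := s) (s₂ := sumCell a' b')) hst'
    replace h3 := h3.ge ⟨h2, hz'⟩
    refine convexHull_mono ?_ h3
    rintro y ⟨hy, hy'⟩
    simp only [Finset.coe_inter, Set.mem_inter_iff, Finset.mem_coe] at hy hy' ⊢
    exact ⟨hy.1, hy'⟩

theorem IsCompatiblePair.card_of_mem_sumCells (h : IsCompatiblePair α β) {t : Finset (E × F)}
    (ht : t ∈ sumCells α β) : t.card = d + e + 1 := by
  obtain ⟨a, b, hab, rfl⟩ := mem_sumCells.1 ht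
  exact hab.card_sumCell h

theorem IsCompatiblePair.mem_faces_of_mem_sumCells (h : IsCompatiblePair α β)
    {t : Finset (E × F)} (ht : t ∈ sumCells α β) : t ∈ h.complex.faces := by
  refine ⟨Finset.card_pos.1 ?_, t, ht, subset_rfl⟩
  rw [h.card_of_mem_sumCells ht]
  omega

theorem IsCompatiblePair.facets_complex (h : IsCompatiblePair α β) :
    h.complex.facets = sumCells α β := by
  ext s
  constructor
  · rintro ⟨⟨-, t, ht, hst⟩, hmax⟩
    exact hmax (h.mem_faces_of_mem_sumCells ht) hst ▸ ht
  · refine fun hs => ⟨h.mem_faces_of_mem_sumCells hs, ?_⟩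
    rintro t ⟨-, t', ht', htt'⟩ hst
    have h1 := Finset.eq_of_subset_of_card_le (hst.trans htt')
      (by rw [h.card_of_mem_sumCells hs, h.card_of_mem_sumCells ht'])
    exact hst.antisymm (h1 ▸ htt')

theorem IsCompatiblePair.top_faces_complex (h : IsCompatiblePair α β) :
    {s | s ∈ h.complex.faces ∧ s.card = d + e + 1} = sumCells α β := by
  ext s
  constructor
  · rintro ⟨⟨-, t, ht, hst⟩, hcard⟩
    rwa [Finset.eq_of_subset_of_card_le hst (by rw [hcard, h.card_of_mem_sumCells ht])]
  · exact fun hs => ⟨h.mem_faces_of_mem_sumCells hs, h.card_of_mem_sumCells hs⟩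

theorem IsCompatiblePair.isTriangulation_complex (h : IsCompatiblePair α β) {P : Set E}
    {Q : Set F} (hKP : IsTriangulation KP P) (hKQ : IsTriangulation KQ Q) (hP : P.Nonempty)
    (hQ : Q.Nonempty) : IsTriangulation h.complex (freeSum P Q) := by
  have hsub : ∀ t ∈ sumCells α β, (t : Set (E × F)) ⊆ freeSum P Q := by
    intro t ht
    obtain ⟨s, r, hsr, rfl⟩ := mem_sumCells.1 ht
    obtain ⟨σ, hσ⟩ := hsr.exists_left h
    obtain ⟨τ, hτ⟩ := hsr.exists_right h
    rw [coe_sumCell]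
    refine freeSum_mono (fun x hx => hKP.vertices_subset ?_) fun y hy => hKQ.vertices_subset ?_
    · rw [SimplicialComplex.vertices_eq]
      exact Set.mem_biUnion σ.2.1 (hσ hx)
    · rw [SimplicialComplex.vertices_eq]
      exact Set.mem_biUnion τ.2.1 (hτ hy)
  refine ⟨?_, subset_antisymm ?_ ?_⟩
  · rintro z ⟨-, t, ht, hzt⟩
    exact hsub t ht (Finset.singleton_subset_iff.1 hzt)
  · intro z hz
    obtain ⟨s, ⟨-, t, ht, hst⟩, hzs⟩ := SimplicialComplex.mem_space_iff.1 hz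
    exact convexHull_mono ((Finset.coe_subset.2 hst).trans (hsub t ht)) hzs
  · intro z hz
    obtain ⟨l, p, q, hl0, hl1, rfl, hp, hq⟩ := exists_of_mem_convexHull_freeSum hz
    obtain ⟨p', hp', hpp⟩ : ∃ p' ∈ KP.space, l • p = l • p' := by
      rw [hKP.space_eq]
      by_cases hl : l = 0
      · obtain ⟨p', hp'⟩ := hP
        exact ⟨p', subset_convexHull _ _ hp', by simp [hl]⟩
      · exact ⟨p, hp hl, rfl⟩
    obtain ⟨q', hq', hqq⟩ : ∃ q' ∈ KQ.space, (1 - l) • q = (1 - l) • q' := by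
      rw [hKQ.space_eq]
      by_cases hl : l = 1
      · obtain ⟨q', hq'⟩ := hQ
        exact ⟨q', subset_convexHull _ _ hq', by simp [hl]⟩
      · exact ⟨q, hq hl, rfl⟩
    rw [hpp, hqq]
    obtain ⟨s, r, hsr, hz⟩ := h.exists_factorPair
      ⟨(l, p', q'), mem_decompositions.2 ⟨⟨hl0, hl1⟩, hp', hq', rfl⟩⟩
    exact SimplicialComplex.convexHull_subset_space
      (h.mem_faces_of_mem_sumCells (mem_sumCells.2 ⟨s, r, hsr, rfl⟩)) hz

end Cover

/-! ### Proper webs yield compatible pairs -/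

section Transposed

variable {E F : Type*} [NormedAddCommGroup E] [NormedSpace ℝ E]
  [NormedAddCommGroup F] [NormedSpace ℝ F]

/-- A top simplex contained in a generator equals it by cardinality, so generating a subcomplex adds
no further top cells. -/
theorem compatible_transposed {d e : ℕ} {KP : SimplicialComplex ℝ E} {KQ : SimplicialComplex ℝ F}
    (α : Cell KP d → SimplicialComplex ℝ F) :
    Compatible α (transposed (e := e) (KQ := KQ) α) := by
  intro σ τ
  constructor
  · rintro ⟨-, σ', hσ', hsub⟩
    have : σ = σ' := Subtype.ext (Finset.eq_of_subset_of_card_le hsub (by rw [σ.2.2, σ'.2.2]))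
    rwa [this]
  · exact fun hτ => ⟨σ.2.1, σ, hτ, subset_rfl⟩

theorem smul_mem_interior_convexHull {P : Set E} (h0 : 0 ∈ interior (convexHull ℝ P)) {x : E}
    (hx : x ∈ convexHull ℝ P) {r : ℝ} (hr0 : 0 ≤ r) (hr1 : r < 1) :
    r • x ∈ interior (convexHull ℝ P) := by
  have := (convex_convexHull ℝ P).combo_interior_self_mem_interior h0 hx
    (by linarith : 0 < 1 - r) hr0 (by ring)
  simpa using this

theorem isCompatiblePair_transposed [FiniteDimensional ℝ E] [FiniteDimensional ℝ F] {d e : ℕ}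
    (hd : finrank ℝ E = d) (he : finrank ℝ F = e) {P : Set E} {Q : Set F} (hP : P.Finite)
    (hQ : Q.Finite) (hP0 : 0 ∈ interior (convexHull ℝ P)) (hQ0 : 0 ∈ interior (convexHull ℝ Q))
    {KP : SimplicialComplex ℝ E} {KQ : SimplicialComplex ℝ F} (hKP : IsTriangulation KP P)
    (hKQ : IsTriangulation KQ Q) {α : Cell KP d → SimplicialComplex ℝ F}
    (hα : IsProperWeb d e KP KQ α) :
    IsCompatiblePair α (transposed (e := e) (KQ := KQ) α) where
  finrank_left := hd
  finrank_right := he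
  finite_left := finite_faces_of_isTriangulation hP hKP
  finite_right := finite_faces_of_isTriangulation hQ hKQ
  cover_left x hx := exists_cell_of_mem_convexHull hd hP hKP ⟨0, hP0⟩ (hKP.space_eq ▸ hx)
  cover_right y hy := exists_cell_of_mem_convexHull he hQ hKQ ⟨0, hQ0⟩ (hKQ.space_eq ▸ hy)
  smul_left x hx r hr0 hr1 := by
    rw [hKP.space_eq] at hx ⊢
    exact smul_mem_interior_convexHull hP0 hx hr0 hr1
  smul_right y hy r hr0 hr1 := by
    rw [hKQ.space_eq] at hy ⊢
    exact smul_mem_interior_convexHull hQ0 hy hr0 hr1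
  le_left σ := (hα.web.mem_starBalls σ).1
  le_right τ := (hα.web_transposed.mem_starBalls τ).1
  body_left σ := isStarBody_of_mem_starBalls he (finite_faces_of_isTriangulation hQ hKQ)
    (hα.web.mem_starBalls σ)
  body_right τ := isStarBody_of_mem_starBalls hd (finite_faces_of_isTriangulation hP hKP)
    (hα.web_transposed.mem_starBalls τ)
  compat := compatible_transposed α

end Transposed

end FreeSumWebs

theorem mainTheorem2 (d e : ℕ)
    (P : Set (EuclideanSpace ℝ (Fin d))) (Q : Set (EuclideanSpace ℝ (Fin e)))
    (hPfin : P.Finite) (hQfin : Q.Finite)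
    (hP0 : 0 ∈ P) (hQ0 : 0 ∈ Q)
    (hPint : 0 ∈ interior (convexHull ℝ P)) (hQint : 0 ∈ interior (convexHull ℝ Q))
    (KP : Geometry.SimplicialComplex ℝ (EuclideanSpace ℝ (Fin d)))
    (KQ : Geometry.SimplicialComplex ℝ (EuclideanSpace ℝ (Fin e)))
    (hKP : FreeSumWebs.IsTriangulation KP P) (hKQ : FreeSumWebs.IsTriangulation KQ Q)
    (α : FreeSumWebs.Cell KP d → Geometry.SimplicialComplex ℝ (EuclideanSpace ℝ (Fin e)))
    (hα : FreeSumWebs.IsProperWeb d e KP KQ α) :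
    ∃ K : Geometry.SimplicialComplex ℝ
        (EuclideanSpace ℝ (Fin d) × EuclideanSpace ℝ (Fin e)),
      (∀ s : Finset (EuclideanSpace ℝ (Fin d) × EuclideanSpace ℝ (Fin e)),
        s ∈ K.faces ↔ s.Nonempty ∧ ∃ t ∈ FreeSumWebs.webCells e KQ α, s ⊆ t) ∧
      K.facets = FreeSumWebs.webCells e KQ α ∧
      {s | s ∈ K.faces ∧ s.card = d + e + 1} = FreeSumWebs.webCells e KQ α ∧
      FreeSumWebs.IsTriangulation K (FreeSumWebs.freeSum P Q) ∧
      FreeSumWebs.IsPSumTriangulation d e P Q KP KQ K := by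
  have h := FreeSumWebs.isCompatiblePair_transposed finrank_euclideanSpace_fin
    finrank_euclideanSpace_fin hPfin hQfin hPint hQint hKP hKQ hα
  have htri := h.isTriangulation_complex hKP hKQ ⟨0, hP0⟩ ⟨0, hQ0⟩
  exact ⟨h.complex, fun s => Iff.rfl, h.facets_complex, h.top_faces_complex, htri, htri, α,
    FreeSumWebs.transposed α, hα.web, hα.web_transposed, FreeSumWebs.compatible_transposed α,
    hα.star, h.top_faces_complex⟩
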